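/- **Setting.** Let $X\subseteq\mathbb R^d$ be a set on which derivatives are uniquely determined (for instance $X=\mathbb R^d$, or a compact convex set with nonempty interior), and let $\mathcal P(X)$ be the set of Borel probability measures concentrated on a compact subset of $X$ (all Borel probability measures on $X$ if $X$ is compact). Let $c:\mathbb R^d\times\mathbb R^d\to\mathbb R$ be a symmetric cost of class $C^1$ (for instance $c(x,y)=\|x-y\|^2$), let $\varepsilon>0$, and let $\mu^*\in\mathcal P(X)$ be the target. For $\mu,\nu\in\mathcal P(X)$ put $$\mathcal W_\varepsilon(\mu,\nu)=\inf_{\pi\in\Pi(\mu,\nu)}\Big\{\int c\,d\pi+\varepsilon\,\mathrm{KL}(\pi\,|\,\mu\otimes\nu)\Big\},$$ where $\Pi(\mu,\nu)$ is the set of couplings of $\mu$ and $\nu$, and let $$\mathcal F_\varepsilon(\mu)=\mathcal W_\varepsilon(\mu,\mu^*)-\tfrac12\mathcal W_\varepsilon(\mu,\mu)-\tfrac12\mathcal W_\varepsilon(\mu^*,\mu^*)$$ be the Sinkhorn divergence to $\mu^*$. A first variation of $\mathcal F_\varepsilon$ at $\mu\in\mathcal P(X)$ is a function $\frac{\delta\mathcal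 F_\varepsilon(\mu)}{\delta\mu}$, integrable with respect to every $\nu\in\mathcal P(X)$, such that for every $\nu\in\mathcal P(X)$ $$\frac{d}{dr}\Big|_{r=0^+}\mathcal F_\varepsilon\big(\mu+r(\nu-\mu)\big)=\int\frac{\delta\mathcal F_\varepsilon(\mu)}{\delta\mu}\,d(\nu-\mu);$$ on $X$ it is unique up to an additive constant. Gradients of first variations are taken within $X$. Let $J\subseteq\mathbb R$ be an interval (for instance $[0,\infty)$) and let $(\mu_t)_{t\in J}$ be a Sinkhorn gradient flow, that is, a weak solution in $\mathcal P(X)$ of $$\partial_t\mu_t=\nabla\cdot\Big(\mu_t\,\nabla\frac{\delta\mathcal F_\varepsilon(\mu_t)}{\delta\mu}\Big),$$ meaning: every $t\in J$ has a neighbourhood in $J$ over which all $\mu_s$ are concentrated on one common compact subset of $X$, and for every $h\in C_c^\infty(\mathbb R^d)$ and $t\in J$, $$\frac{d}{dt}\int h\,d\mu_t=-\int\Big\langle\nabla\frac{\delta\mathcal F_\varepsilon(\mu_t)}{\delta\mu},\nabla h\Big\rangle d\mu_t .$$ (Time derivatives are one-sided at endpoints of $J$.) **Proposition (descending property).** For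 every $t\in J$ the first variation $\frac{\delta\mathcal F_\varepsilon(\mu_t)}{\delta\mu}$ exists and is differentiable on $X$, the squared norm of its gradient is $\mu_t$-integrable, $t\mapsto\mathcal F_\varepsilon(\mu_t)$ is differentiable at $t$, and $$\frac{d}{dt}\mathcal F_\varepsilon(\mu_t)=-\int\Big\|\nabla\frac{\delta\mathcal F_\varepsilon(\mu_t)}{\delta\mu}\Big\|^2d\mu_t\le 0 .$$ Consequently $t\mapsto\mathcal F_\varepsilon(\mu_t)$ is nonincreasing on $J$. -/

import Mathlib

open MeasureTheory Set Filter Topology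
open scoped ContDiff

noncomputable section

namespace Sinkhorn

/-- The Euclidean space `ℝ^d`. -/
abbrev E (d : ℕ) : Type := EuclideanSpace ℝ (Fin d)

/-- `π` is a coupling of `μ` and `ν`: its marginals are `μ` and `ν`. -/
def IsCoupling {d : ℕ} (π : Measure (E d × E d)) (μ ν : Measure (E d)) : Prop :=
  π.map Prod.fst = μ ∧ π.map Prod.snd = ν

/-- Entropy-regularized transport cost
`W_ε(μ, ν) = inf { ∫ c dπ + ε KL(π | μ ⊗ ν) : π coupling of μ and ν }`.
Couplings of infinite relative entropy do not contribute to the infimum. -/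
def entropicCost {d : ℕ} (c : E d → E d → ℝ) (ε : ℝ) (μ ν : Measure (E d)) : ℝ :=
  sInf {r : ℝ | ∃ π : Measure (E d × E d), IsCoupling π μ ν ∧
    Integrable (fun p => c p.1 p.2) π ∧
    InformationTheory.klDiv π (μ.prod ν) ≠ ⊤ ∧
    r = ∫ p, c p.1 p.2 ∂π + ε * (InformationTheory.klDiv π (μ.prod ν)).toReal}

/-- The Sinkhorn divergence to the target `μs`:
`F_ε(μ) = W_ε(μ, μs) - W_ε(μ, μ) / 2 - W_ε(μs, μs) / 2`. -/
def sinkhornDiv {d : ℕ} (c : E d → E d → ℝ) (ε : ℝ) (μs μ : Measure (E d)) : ℝ :=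
  entropicCost c ε μ μs - entropicCost c ε μ μ / 2 - entropicCost c ε μs μs / 2

/-- Borel probability measures concentrated on a compact subset of `X`
(all Borel probability measures on `X` when `X` is compact). -/
def MemP {d : ℕ} (X : Set (E d)) (μ : Measure (E d)) : Prop :=
  IsProbabilityMeasure μ ∧ ∃ K ⊆ X, IsCompact K ∧ μ Kᶜ = 0

/-- The perturbed measure `μ + r (ν - μ)`, for `0 ≤ r ≤ 1`. -/
def perturb {d : ℕ} (μ ν : Measure (E d)) (r : ℝ) : Measure (E d) :=
  ENNReal.ofReal (1 - r) • μ + ENNReal.ofReal r • ν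

/-- `φ` is a first variation of `F` at `μ`: for every perturbation `χ = ν - μ` with `ν` in `P(X)`
(up to a positive factor, these are the `χ` for which `μ + r χ` is in `P(X)` for small `r ≥ 0`),
the derivative of `r ↦ F (μ + r χ)` at `r = 0` is `∫ φ dχ`.
On `X`, this determines `φ` up to an additive constant, as one sees from Dirac masses `ν`. -/
def IsFirstVariation {d : ℕ} (X : Set (E d)) (F : Measure (E d) → ℝ) (μ : Measure (E d))
    (φ : E d → ℝ) : Prop :=
  (∀ ν, MemP X ν → Integrable φ ν) ∧
  ∀ ν, MemP X ν →
    HasDerivWithinAt (fun r : ℝ => F (perturb μ ν r)) (∫ x, φ x ∂ν - ∫ x, φ x ∂μ) (Ici 0) 0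

open Classical in
/-- The first variation `δF(μ)/δμ`, a chosen representative modulo additive constants
(the zero function if there is none). -/
def firstVariation {d : ℕ} (X : Set (E d)) (F : Measure (E d) → ℝ) (μ : Measure (E d)) :
    E d → ℝ :=
  if h : ∃ φ, IsFirstVariation X F μ φ then h.choose else 0

/-- The gradient in `X` of the first variation, `∇ (δF(μ)/δμ)`. -/
def wassersteinGrad {d : ℕ} (X : Set (E d)) (F : Measure (E d) → ℝ) (μ : Measure (E d))
    (x : E d) : E d :=
  gradientWithin (firstVariation X F μ) X x

/-- `μ` is a weak solution, over the time interval `J`, in the probability measures on `X`, of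
`∂ₜ μₜ = ∇ · (μₜ ∇ (δF(μₜ)/δμ))`, with support compact in `X` locally uniformly in time. -/
structure IsGradientFlow {d : ℕ} (X : Set (E d)) (F : Measure (E d) → ℝ) (J : Set ℝ)
    (μ : ℝ → Measure (E d)) : Prop where
  prob : ∀ t ∈ J, IsProbabilityMeasure (μ t)
  supp : ∀ t ∈ J, ∃ K ⊆ X, IsCompact K ∧ ∀ᶠ s in 𝓝[J] t, μ s Kᶜ = 0
  weak : ∀ h : E d → ℝ, ContDiff ℝ ∞ h → HasCompactSupport h → ∀ t ∈ J,
    HasDerivWithinAt (fun s => ∫ x, h x ∂(μ s))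
      (-∫ x, inner ℝ (wassersteinGrad X F (μ t) x) (gradient h x) ∂(μ t)) J t

end Sinkhorn

end

/-!
The soft `c`-transforms contract the oscillation of functions, by Doeblin's argument, so their
composition has a fixed point: a pair `(f₀, g₀)` of Schrödinger potentials of `(μ₀, ν₀)`. Its two
equations define `f₀` and `g₀` on the whole space and make them `C¹`.

Let `μ` and `ν` be at distance `r` from `μ₀` and `ν₀` in the dual of the `C¹` norm. Testing the
dual problem of `W_ε(μ, ν)` with `(f₀, g₀)` bounds it below. The Gibbs density of `(f₀, g₀)` has
marginals which are wrong by `O(r)` only; balancing them yields a coupling, whose cost exceeds this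
bound by `O(r²)`. The second difference of the `C¹` Gibbs kernel being `o(r)`, both bounds equal
`W_ε(μ₀, ν₀) + ∫ f₀ d(μ - μ₀) + ∫ g₀ d(ν - ν₀) + o(r)`. Hence `F_ε` has a `C¹` derivative `φ` at
each measure for the dual of the `C¹` norm, which is in particular a first variation.

The weak equation makes a gradient flow Lipschitz in this dual norm, so the chain rule gives
`(F_ε ∘ m)' = d/ds ∫ φ d(m s)`, which the weak equation tested with `φ` identifies as the negative
of the dissipation.
-/

open InformationTheory

namespace Sinkhorn

section RelativeEntropy

variable {α : Type*} [MeasurableSpace α]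

lemma mul_le_klFun_add_exp {ρ : ℝ} (hρ : 0 ≤ ρ) (u : ℝ) :
    ρ * u ≤ klFun ρ + (Real.exp u - 1) := by
  rw [klFun_apply]
  rcases hρ.eq_or_lt with rfl | hρ
  · linarith [Real.exp_pos u]
  · have h := Real.add_one_le_exp (u - Real.log ρ)
    rw [Real.exp_sub, Real.exp_log hρ, le_div_iff₀ hρ] at h
    linarith

lemma integral_le_klDiv_add_integral_exp {P Q : Measure α} [IsFiniteMeasure P]
    [IsFiniteMeasure Q] (hkl : klDiv P Q ≠ ⊤) {u : α → ℝ}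
    (hu : Integrable u P) (hexp : Integrable (fun x => Real.exp (u x) - 1) Q) :
    ∫ x, u x ∂P ≤ (klDiv P Q).toReal + ∫ x, (Real.exp (u x) - 1) ∂Q := by
  obtain ⟨hac, hllr⟩ := klDiv_ne_top_iff.1 hkl
  have hk := (integrable_klFun_rnDeriv_iff hac).2 hllr
  rw [← integral_rnDeriv_smul hac, toReal_klDiv_eq_integral_klFun hac, ← integral_add hk hexp]
  exact integral_mono ((integrable_rnDeriv_smul_iff hac).2 hu) (hk.add hexp) fun x =>
    mul_le_klFun_add_exp ENNReal.toReal_nonneg (u x)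

variable {Q : Measure α} {D : α → ℝ}

lemma integral_withDensity_ofReal (hD : Measurable D) (hD0 : ∀ᵐ x ∂Q, 0 ≤ D x) (u : α → ℝ) :
    ∫ x, u x ∂(Q.withDensity fun x => ENNReal.ofReal (D x)) = ∫ x, D x * u x ∂Q := by
  rw [integral_withDensity_eq_integral_toReal_smul (by fun_prop) (by simp)]
  refine integral_congr_ae ?_
  filter_upwards [hD0] with x hx
  rw [ENNReal.toReal_ofReal hx, smul_eq_mul]

lemma integrable_withDensity_ofReal (hD : Measurable D) (hD0 : ∀ᵐ x ∂Q, 0 ≤ D x) {u : α → ℝ} :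
    Integrable u (Q.withDensity fun x => ENNReal.ofReal (D x)) ↔
      Integrable (fun x => D x * u x) Q := by
  rw [integrable_withDensity_iff_integrable_smul' (by fun_prop) (by simp)]
  refine integrable_congr ?_
  filter_upwards [hD0] with x hx
  rw [ENNReal.toReal_ofReal hx, smul_eq_mul]

lemma klDiv_withDensity_ofReal [IsFiniteMeasure Q] (hDi : Integrable D Q)
    (hD : Measurable D) (hD0 : ∀ᵐ x ∂Q, 0 ≤ D x) (hkl : Integrable (fun x => klFun (D x)) Q) :
    klDiv (Q.withDensity fun x => ENNReal.ofReal (D x)) Q =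
      ENNReal.ofReal (∫ x, klFun (D x) ∂Q) := by
  have := isFiniteMeasure_withDensity_ofReal hDi.2
  rw [klDiv_eq_lintegral_klFun_of_ac (withDensity_absolutelyContinuous _ _),
    ofReal_integral_eq_lintegral_ofReal hkl (hD0.mono fun x hx => klFun_nonneg hx)]
  refine lintegral_congr_ae ?_
  filter_upwards [Q.rnDeriv_withDensity hD.ennreal_ofReal, hD0] with x hx hx0
  rw [hx, ENNReal.toReal_ofReal hx0]

end RelativeEntropy

section Measures

variable {α β : Type*} [MeasurableSpace α] [MeasurableSpace β]

lemma prod_compl_null {μ : Measure α} {ν : Measure β} [SFinite ν] {K : Set α} {L : Set β}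
    (hμ : μ Kᶜ = 0) (hν : ν Lᶜ = 0) : (μ.prod ν) (K ×ˢ L)ᶜ = 0 := by
  rw [compl_prod_eq_union]
  refine measure_union_null ?_ ?_ <;> rw [Measure.prod_prod] <;> simp [hμ, hν]

lemma map_fst_withDensity_prod {μ : Measure α} {ν : Measure β} [SFinite ν]
    {D : α × β → ENNReal} (hD : Measurable D) (h : ∀ᵐ x ∂μ, ∫⁻ y, D (x, y) ∂ν = 1) :
    ((μ.prod ν).withDensity D).map Prod.fst = μ := by
  ext s hs
  rw [Measure.map_apply measurable_fst hs, withDensity_apply _ (measurable_fst hs),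
    ← lintegral_indicator (measurable_fst hs),
    lintegral_prod _ (hD.indicator (measurable_fst hs)).aemeasurable, ← lintegral_indicator_one hs]
  refine lintegral_congr_ae ?_
  filter_upwards [h] with x hx
  by_cases hxs : x ∈ s <;> simp [indicator, hxs, hx]

lemma map_snd_withDensity_prod {μ : Measure α} {ν : Measure β} [SFinite μ] [SFinite ν]
    {D : α × β → ENNReal} (hD : Measurable D) (h : ∀ᵐ y ∂ν, ∫⁻ x, D (x, y) ∂μ = 1) :
    ((μ.prod ν).withDensity D).map Prod.snd = ν := by
  ext s hs
  rw [Measure.map_apply measurable_snd hs, withDensity_apply _ (measurable_snd hs),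
    ← lintegral_indicator (measurable_snd hs),
    lintegral_prod_symm _ (hD.indicator (measurable_snd hs)).aemeasurable,
    ← lintegral_indicator_one hs]
  refine lintegral_congr_ae ?_
  filter_upwards [h] with y hy
  by_cases hys : y ∈ s <;> simp [indicator, hys, hy]

lemma norm_integral_le_of_compl_null {F : Type*} [NormedAddCommGroup F] [NormedSpace ℝ F]
    {μ : Measure α} [IsProbabilityMeasure μ] {K : Set α} (hμ : μ Kᶜ = 0)
    {h : α → F} {B : ℝ} (hB : ∀ x ∈ K, ‖h x‖ ≤ B) : ‖∫ x, h x ∂μ‖ ≤ B := by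
  simpa using norm_integral_le_of_norm_le_const
    ((show ∀ᵐ x ∂μ, x ∈ K from mem_ae_iff.2 hμ).mono hB)

lemma integrable_of_continuousOn_of_compl_null [TopologicalSpace α] [OpensMeasurableSpace α]
    [T2Space α] {F : Type*} [NormedAddCommGroup F] [SecondCountableTopologyEither α F]
    {μ : Measure α} [IsFiniteMeasureOnCompacts μ] {K : Set α} (hK : IsCompact K) (hμ : μ Kᶜ = 0)
    {h : α → F} (hh : ContinuousOn h K) : Integrable h μ := by
  rw [← Measure.restrict_eq_self_of_ae_mem (mem_ae_iff.2 hμ)]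
  exact hh.integrableOn_compact hK

lemma integrable_prod_of_continuous [TopologicalSpace α] [TopologicalSpace β]
    [OpensMeasurableSpace (α × β)] [T2Space α] [T2Space β]
    {μ : Measure α} {ν : Measure β} [IsFiniteMeasure μ] [IsFiniteMeasure ν] {K : Set α}
    {L : Set β} (hK : IsCompact K) (hL : IsCompact L) (hμ : μ Kᶜ = 0) (hν : ν Lᶜ = 0)
    {h : α × β → ℝ} (hh : Continuous h) : Integrable h (μ.prod ν) :=
  integrable_of_continuousOn_of_compl_null (hK.prod hL) (prod_compl_null hμ hν) hh.continuousOn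

end Measures

section BalancedDensity

variable {α β : Type*} [MeasurableSpace α] [MeasurableSpace β] {μ : Measure α} {ν : Measure β}
  {G : α × β → ℝ}

/-- The density obtained from `G` by adding functions of `x` and of `y` so that both of its
marginals become exactly uniform. -/
noncomputable def balancedDensity (μ : Measure α) (ν : Measure β) (G : α × β → ℝ)
    (p : α × β) : ℝ :=
  G p + ((1 - ∫ y, G (p.1, y) ∂ν) + (1 - ∫ x, G (x, p.2) ∂μ) - (1 - ∫ q, G q ∂(μ.prod ν)))

lemma integral_balancedDensity_snd [SFinite μ] [IsProbabilityMeasure ν]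
    (hG : Integrable G (μ.prod ν)) {x : α} (hx : Integrable (fun y => G (x, y)) ν) :
    ∫ y, balancedDensity μ ν G (x, y) ∂ν = 1 := by
  have hG' : Integrable (fun y => ∫ x, G (x, y) ∂μ) ν := hG.integral_prod_right
  have hsub : Integrable (fun y => G (x, y) - ∫ x', G (x', y) ∂μ) ν := hx.sub hG'
  calc ∫ y, balancedDensity μ ν G (x, y) ∂ν
      = ∫ y, (G (x, y) - (∫ x', G (x', y) ∂μ)
          + (1 - ∫ y', G (x, y') ∂ν + ∫ q, G q ∂(μ.prod ν))) ∂ν := by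
        refine integral_congr_ae (.of_forall fun y => ?_)
        simp only [balancedDensity]; ring
    _ = 1 := by
        rw [integral_add hsub (integrable_const _), integral_sub hx hG',
          integral_prod_symm _ hG]
        simp

lemma integral_balancedDensity_fst [IsProbabilityMeasure μ] [SFinite ν]
    (hG : Integrable G (μ.prod ν)) {y : β} (hy : Integrable (fun x => G (x, y)) μ) :
    ∫ x, balancedDensity μ ν G (x, y) ∂μ = 1 := by
  have hG' : Integrable (fun x => ∫ y, G (x, y) ∂ν) μ := hG.integral_prod_left
  have hsub : Integrable (fun x => G (x, y) - ∫ y', G (x, y') ∂ν) μ := hy.sub hG'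
  calc ∫ x, balancedDensity μ ν G (x, y) ∂μ
      = ∫ x, (G (x, y) - (∫ y', G (x, y') ∂ν)
          + (1 - ∫ x', G (x', y) ∂μ + ∫ q, G q ∂(μ.prod ν))) ∂μ := by
        refine integral_congr_ae (.of_forall fun x => ?_)
        simp only [balancedDensity]; ring
    _ = 1 := by
        rw [integral_add hsub (integrable_const _), integral_sub hy hG',
          integral_prod _ hG]
        simp

lemma abs_balancedDensity_sub_le [IsProbabilityMeasure μ] [SFinite ν] (hG : Integrable G (μ.prod ν))
    {K : Set α} {L : Set β} (hμ : μ Kᶜ = 0) {κ : ℝ} (h₁ : ∀ x ∈ K, |∫ y, G (x, y) ∂ν - 1| ≤ κ)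
    (h₂ : ∀ y ∈ L, |∫ x, G (x, y) ∂μ - 1| ≤ κ) {p : α × β} (hp : p ∈ K ×ˢ L) :
    |balancedDensity μ ν G p - G p| ≤ 3 * κ := by
  have hmass : |∫ q, G q ∂(μ.prod ν) - 1| ≤ κ := by
    have h := norm_integral_le_of_compl_null (h := fun x => ∫ y, G (x, y) ∂ν - 1) hμ h₁
    rw [integral_sub hG.integral_prod_left (integrable_const 1), ← integral_prod _ hG] at h
    simpa using h
  have hx := abs_le.1 (h₁ p.1 hp.1)
  have hy := abs_le.1 (h₂ p.2 hp.2)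
  have hm := abs_le.1 hmass
  simp only [balancedDensity]
  rw [abs_le]
  constructor <;> linarith [hx.1, hx.2, hy.1, hy.2, hm.1, hm.2]

end BalancedDensity

lemma klFun_le_mul_log_add {a b : ℝ} (ha : 0 < a) (hb : 0 ≤ b) :
    klFun b ≤ b * Real.log a + 1 - a + (b - a) ^ 2 / a := by
  have hlog : b * Real.log b ≤ b * (Real.log a + b / a - 1) := by
    rcases hb.eq_or_lt with rfl | hb
    · simp
    · have h := Real.log_le_sub_one_of_pos (div_pos hb ha)
      rw [Real.log_div hb.ne' ha.ne'] at h
      exact mul_le_mul_of_nonneg_left (by linarith) hb.le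
  calc klFun b = b * Real.log b + 1 - b := klFun_apply b
    _ ≤ b * (Real.log a + b / a - 1) + 1 - b := by linarith
    _ = b * Real.log a + 1 - a + (b - a) ^ 2 / a := by field_simp; ring

lemma continuous_integral_of_compl_null {X Y : Type*} [TopologicalSpace X]
    [FirstCountableTopology X] [LocallyCompactSpace X] [TopologicalSpace Y] [T2Space Y]
    [MeasurableSpace Y] [OpensMeasurableSpace Y] {F : Type*} [NormedAddCommGroup F]
    [NormedSpace ℝ F] [SecondCountableTopologyEither Y F] {ν : Measure Y}
    [IsLocallyFiniteMeasure ν] {L : Set Y} (hL : IsCompact L) (hν : ν Lᶜ = 0) {h : X → Y → F}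
    (hh : Continuous (Function.uncurry h)) :
    Continuous fun x => ∫ y, h x y ∂ν := by
  have := continuous_parametric_integral_of_continuous (μ := ν) hh hL
  rwa [Measure.restrict_eq_self_of_ae_mem (mem_ae_iff.2 hν)] at this

lemma continuous_balancedDensity {X Y : Type*} [TopologicalSpace X] [FirstCountableTopology X]
    [LocallyCompactSpace X] [T2Space X] [MeasurableSpace X] [OpensMeasurableSpace X]
    [TopologicalSpace Y] [FirstCountableTopology Y] [LocallyCompactSpace Y] [T2Space Y]
    [MeasurableSpace Y] [OpensMeasurableSpace Y] {μ : Measure X} {ν : Measure Y}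
    [IsLocallyFiniteMeasure μ] [IsLocallyFiniteMeasure ν] {K : Set X} {L : Set Y}
    (hK : IsCompact K) (hL : IsCompact L) (hμ : μ Kᶜ = 0) (hν : ν Lᶜ = 0) {G : X × Y → ℝ}
    (hG : Continuous G) : Continuous (balancedDensity μ ν G) := by
  have h₁ : Continuous fun x => ∫ y, G (x, y) ∂ν := continuous_integral_of_compl_null hL hν hG
  have h₂ : Continuous fun y => ∫ x, G (x, y) ∂μ :=
    continuous_integral_of_compl_null hK hμ (h := fun y x => G (x, y)) (hG.comp continuous_swap)
  exact hG.add (((continuous_const.sub (h₁.comp continuous_fst)).add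
    (continuous_const.sub (h₂.comp continuous_snd))).sub continuous_const)

section Duality

variable {d : ℕ} {c : E d → E d → ℝ} {ε : ℝ} {μ ν : Measure (E d)} {K : Set (E d)} {f g : E d → ℝ}

lemma IsCoupling.integral_fst {π : Measure (E d × E d)} (h : IsCoupling π μ ν)
    (hf : Continuous f) : ∫ p, f p.1 ∂π = ∫ x, f x ∂μ := by
  rw [← h.1, integral_map (by fun_prop) hf.aestronglyMeasurable]

lemma IsCoupling.integral_snd {π : Measure (E d × E d)} (h : IsCoupling π μ ν)
    (hg : Continuous g) : ∫ p, g p.2 ∂π = ∫ y, g y ∂ν := by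
  rw [← h.2, integral_map (by fun_prop) hg.aestronglyMeasurable]

lemma IsCoupling.isProbabilityMeasure [IsProbabilityMeasure μ] {π : Measure (E d × E d)}
    (h : IsCoupling π μ ν) : IsProbabilityMeasure π := by
  have : IsProbabilityMeasure (π.map Prod.fst) := by rw [h.1]; infer_instance
  exact Measure.isProbabilityMeasure_of_map Prod.fst

/-- The Gibbs kernel `exp ((f ⊕ g - c) / ε)`, the density with respect to `μ ⊗ ν` of the optimal
coupling when `f` and `g` are Schrödinger potentials of `μ` and `ν`. -/
noncomputable def gibbsKernel (c : E d → E d → ℝ) (ε : ℝ) (f g : E d → ℝ) (p : E d × E d) : ℝ :=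
  Real.exp ((f p.1 + g p.2 - c p.1 p.2) / ε)

/-- The functional whose supremum over `f` and `g` is the entropic cost `W_ε(μ, ν)`. -/
noncomputable def dualValue (c : E d → E d → ℝ) (ε : ℝ) (μ ν : Measure (E d)) (f g : E d → ℝ) : ℝ :=
  ∫ x, f x ∂μ + ∫ y, g y ∂ν - ε * ∫ p, (gibbsKernel c ε f g p - 1) ∂(μ.prod ν)

lemma gibbsKernel_pos (p : E d × E d) : 0 < gibbsKernel c ε f g p := Real.exp_pos _

lemma continuous_gibbsKernel (hc : Continuous (Function.uncurry c)) (hf : Continuous f)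
    (hg : Continuous g) : Continuous (gibbsKernel c ε f g) := by
  have hc' : Continuous fun p : E d × E d => c p.1 p.2 := hc
  unfold gibbsKernel
  fun_prop

lemma mul_cost_add_klFun_le (hε : 0 < ε) {D : ℝ} (hD : 0 ≤ D) (p : E d × E d) :
    D * c p.1 p.2 + ε * klFun D ≤ D * f p.1 + D * g p.2 - ε * (gibbsKernel c ε f g p - 1)
      + ε * ((D - gibbsKernel c ε f g p) ^ 2 / gibbsKernel c ε f g p) := by
  have hlog : ε * Real.log (gibbsKernel c ε f g p) = f p.1 + g p.2 - c p.1 p.2 := by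
    rw [gibbsKernel, Real.log_exp, mul_div_cancel₀ _ hε.ne']
  have h := mul_le_mul_of_nonneg_left
    (klFun_le_mul_log_add (gibbsKernel_pos (c := c) (ε := ε) (f := f) (g := g) p) hD) hε.le
  linear_combination h + D * hlog

variable [IsProbabilityMeasure μ] [IsProbabilityMeasure ν]

lemma dualValue_le_of_isCoupling (hc : Continuous (Function.uncurry c)) (hε : 0 < ε)
    (hK : IsCompact K) (hμ : μ Kᶜ = 0) (hν : ν Kᶜ = 0) (hf : Continuous f) (hg : Continuous g)
    {π : Measure (E d × E d)} (hπ : IsCoupling π μ ν) (hci : Integrable (fun p => c p.1 p.2) π)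
    (hkl : klDiv π (μ.prod ν) ≠ ⊤) :
    dualValue c ε μ ν f g ≤ ∫ p, c p.1 p.2 ∂π + ε * (klDiv π (μ.prod ν)).toReal := by
  have := hπ.isProbabilityMeasure
  have hfi : Integrable (fun p : E d × E d => f p.1) π := by
    refine Integrable.comp_measurable (g := f) ?_ measurable_fst
    rw [hπ.1]
    exact integrable_of_continuousOn_of_compl_null hK hμ hf.continuousOn
  have hgi : Integrable (fun p : E d × E d => g p.2) π := by
    refine Integrable.comp_measurable (g := g) ?_ measurable_snd
    rw [hπ.2]
    exact integrable_of_continuousOn_of_compl_null hK hν hg.continuousOn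
  have hfg : Integrable (fun p : E d × E d => f p.1 + g p.2) π := hfi.add hgi
  have hexp : Integrable (fun p => gibbsKernel c ε f g p - 1) (μ.prod ν) :=
    integrable_prod_of_continuous hK hK hμ hν
      ((continuous_gibbsKernel hc hf hg).sub continuous_const)
  have h := integral_le_klDiv_add_integral_exp hkl ((hfg.sub hci).div_const ε) hexp
  simp only [Pi.sub_apply] at h
  rw [integral_div, integral_sub hfg hci, integral_add hfi hgi, hπ.integral_fst hf,
    hπ.integral_snd hg, div_le_iff₀ hε] at h
  simp only [dualValue, gibbsKernel]
  linarith

lemma dualValue_le_entropicCost (hc : Continuous (Function.uncurry c)) (hε : 0 < ε)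
    (hK : IsCompact K) (hμ : μ Kᶜ = 0) (hν : ν Kᶜ = 0) (hf : Continuous f) (hg : Continuous g) :
    dualValue c ε μ ν f g ≤ entropicCost c ε μ ν := by
  refine le_csInf ⟨_, μ.prod ν, ⟨by simp, by simp⟩,
    integrable_prod_of_continuous hK hK hμ hν hc, by simp, rfl⟩ ?_
  rintro r ⟨π, hπ, hci, hkl, rfl⟩
  exact dualValue_le_of_isCoupling hc hε hK hμ hν hf hg hπ hci hkl

lemma entropicCost_le_of_isCoupling (hc : Continuous (Function.uncurry c)) (hε : 0 < ε)
    (hK : IsCompact K) (hμ : μ Kᶜ = 0) (hν : ν Kᶜ = 0) {π : Measure (E d × E d)}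
    (hπ : IsCoupling π μ ν) (hci : Integrable (fun p => c p.1 p.2) π)
    (hkl : klDiv π (μ.prod ν) ≠ ⊤) :
    entropicCost c ε μ ν ≤ ∫ p, c p.1 p.2 ∂π + ε * (klDiv π (μ.prod ν)).toReal := by
  refine csInf_le ⟨dualValue c ε μ ν 0 0, ?_⟩ ⟨π, hπ, hci, hkl, rfl⟩
  rintro r ⟨π', hπ', hci', hkl', rfl⟩
  exact dualValue_le_of_isCoupling hc hε hK hμ hν continuous_zero continuous_zero hπ' hci' hkl'

lemma isCoupling_withDensity_ofReal (hK : IsCompact K) (hμ : μ Kᶜ = 0) (hν : ν Kᶜ = 0)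
    {D : E d × E d → ℝ} (hD : Continuous D) (hD0 : ∀ p ∈ K ×ˢ K, 0 ≤ D p)
    (h₁ : ∀ x, ∫ y, D (x, y) ∂ν = 1) (h₂ : ∀ y, ∫ x, D (x, y) ∂μ = 1) :
    IsCoupling ((μ.prod ν).withDensity fun p => ENNReal.ofReal (D p)) μ ν := by
  have hm : Measurable fun p => ENNReal.ofReal (D p) := hD.measurable.ennreal_ofReal
  have hμK : ∀ᵐ x ∂μ, x ∈ K := mem_ae_iff.2 hμ
  have hνK : ∀ᵐ y ∂ν, y ∈ K := mem_ae_iff.2 hν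
  refine ⟨map_fst_withDensity_prod hm ?_, map_snd_withDensity_prod hm ?_⟩
  · filter_upwards [hμK] with x hx
    rw [← ofReal_integral_eq_lintegral_ofReal _ (hνK.mono fun y hy => hD0 _ ⟨hx, hy⟩), h₁,
      ENNReal.ofReal_one]
    exact integrable_of_continuousOn_of_compl_null hK hν (by fun_prop)
  · filter_upwards [hνK] with y hy
    rw [← ofReal_integral_eq_lintegral_ofReal _ (hμK.mono fun x hx => hD0 _ ⟨hx, hy⟩), h₂,
      ENNReal.ofReal_one]
    exact integrable_of_continuousOn_of_compl_null hK hμ (by fun_prop)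

lemma entropicCost_le_integral_density (hc : Continuous (Function.uncurry c)) (hε : 0 < ε)
    (hK : IsCompact K) (hμ : μ Kᶜ = 0) (hν : ν Kᶜ = 0) {D : E d × E d → ℝ} (hD : Continuous D)
    (hD0 : ∀ p ∈ K ×ˢ K, 0 ≤ D p) (h₁ : ∀ x, ∫ y, D (x, y) ∂ν = 1)
    (h₂ : ∀ y, ∫ x, D (x, y) ∂μ = 1) :
    entropicCost c ε μ ν ≤ ∫ p, (D p * c p.1 p.2 + ε * klFun (D p)) ∂(μ.prod ν) := by
  have hD0' : ∀ᵐ p ∂(μ.prod ν), 0 ≤ D p :=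
    (show ∀ᵐ p ∂(μ.prod ν), p ∈ K ×ˢ K from mem_ae_iff.2 (prod_compl_null hμ hν)).mono hD0
  have hint {u : E d × E d → ℝ} (hu : Continuous u) : Integrable u (μ.prod ν) :=
    integrable_prod_of_continuous hK hK hμ hν hu
  have hDc : Integrable (fun p => D p * c p.1 p.2) (μ.prod ν) := hint (hD.mul hc)
  have hDkl : Integrable (fun p => klFun (D p)) (μ.prod ν) := hint (continuous_klFun.comp hD)
  have hkl := klDiv_withDensity_ofReal (hint hD) hD.measurable hD0' hDkl
  refine (entropicCost_le_of_isCoupling hc hε hK hμ hν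
    (isCoupling_withDensity_ofReal hK hμ hν hD hD0 h₁ h₂)
    ((integrable_withDensity_ofReal hD.measurable hD0').2 hDc)
    (hkl ▸ ENNReal.ofReal_ne_top)).trans_eq ?_
  rw [hkl, ENNReal.toReal_ofReal (integral_nonneg_of_ae (hD0'.mono fun p hp => klFun_nonneg hp)),
    integral_withDensity_ofReal hD.measurable hD0', ← integral_const_mul,
    ← integral_add hDc (hDkl.const_mul ε)]

lemma integral_density_mul_add (hK : IsCompact K) (hμ : μ Kᶜ = 0) (hν : ν Kᶜ = 0)
    (hf : Continuous f) (hg : Continuous g) {D : E d × E d → ℝ} (hD : Continuous D)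
    (h₁ : ∀ x, ∫ y, D (x, y) ∂ν = 1) (h₂ : ∀ y, ∫ x, D (x, y) ∂μ = 1) :
    ∫ p, (D p * f p.1 + D p * g p.2) ∂(μ.prod ν) = ∫ x, f x ∂μ + ∫ y, g y ∂ν := by
  have hint {u : E d × E d → ℝ} (hu : Continuous u) : Integrable u (μ.prod ν) :=
    integrable_prod_of_continuous hK hK hμ hν hu
  rw [integral_add (hint (by fun_prop)) (hint (by fun_prop)),
    integral_prod _ (hint (by fun_prop)), integral_prod_symm _ (hint (by fun_prop))]
  simp [integral_mul_const, h₁, h₂]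

lemma entropicCost_le_dualValue_add (hc : Continuous (Function.uncurry c)) (hε : 0 < ε)
    (hK : IsCompact K) (hμ : μ Kᶜ = 0) (hν : ν Kᶜ = 0) (hf : Continuous f) (hg : Continuous g)
    {κ b : ℝ} (hb : ∀ p ∈ K ×ˢ K, b ≤ gibbsKernel c ε f g p) (hκ : 3 * κ ≤ b) (hb0 : 0 < b)
    (h₁ : ∀ x ∈ K, |∫ y, gibbsKernel c ε f g (x, y) ∂ν - 1| ≤ κ)
    (h₂ : ∀ y ∈ K, |∫ x, gibbsKernel c ε f g (x, y) ∂μ - 1| ≤ κ) :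
    entropicCost c ε μ ν ≤ dualValue c ε μ ν f g + ε * ((3 * κ) ^ 2 / b) := by
  set G := gibbsKernel c ε f g
  set D := balancedDensity μ ν G
  have hG : Continuous G := continuous_gibbsKernel hc hf hg
  have hD : Continuous D := continuous_balancedDensity hK hK hμ hν hG
  have hint {u : E d × E d → ℝ} (hu : Continuous u) : Integrable u (μ.prod ν) :=
    integrable_prod_of_continuous hK hK hμ hν hu
  have hD₁ (x : E d) : ∫ y, D (x, y) ∂ν = 1 := integral_balancedDensity_snd (hint hG)
    (integrable_of_continuousOn_of_compl_null hK hν (by fun_prop))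
  have hD₂ (y : E d) : ∫ x, D (x, y) ∂μ = 1 := integral_balancedDensity_fst (hint hG)
    (integrable_of_continuousOn_of_compl_null hK hμ (by fun_prop))
  have hDG {p : E d × E d} (hp : p ∈ K ×ˢ K) : |D p - G p| ≤ 3 * κ :=
    abs_balancedDensity_sub_le (hint hG) hμ h₁ h₂ hp
  have hD0 (p : E d × E d) (hp : p ∈ K ×ˢ K) : 0 ≤ D p := by
    linarith [hb p hp, (abs_le.1 (hDG hp)).1]
  have hpt (p : E d × E d) (hp : p ∈ K ×ˢ K) : D p * c p.1 p.2 + ε * klFun (D p) ≤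
      D p * f p.1 + D p * g p.2 - ε * (G p - 1) + ε * ((3 * κ) ^ 2 / b) := by
    have hsq : (D p - G p) ^ 2 ≤ (3 * κ) ^ 2 :=
      sq_le_sq' (abs_le.1 (hDG hp)).1 (abs_le.1 (hDG hp)).2
    refine (mul_cost_add_klFun_le hε (hD0 p hp) p).trans (add_le_add_right ?_ _)
    exact mul_le_mul_of_nonneg_left (div_le_div₀ (sq_nonneg _) hsq hb0 (hb p hp)) hε.le
  calc entropicCost c ε μ ν ≤ ∫ p, (D p * c p.1 p.2 + ε * klFun (D p)) ∂(μ.prod ν) :=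
        entropicCost_le_integral_density hc hε hK hμ hν hD hD0 hD₁ hD₂
    _ ≤ ∫ p, (D p * f p.1 + D p * g p.2 - ε * (G p - 1) + ε * ((3 * κ) ^ 2 / b)) ∂(μ.prod ν) :=
        integral_mono_ae (hint ((hD.mul hc).add ((continuous_klFun.comp hD).const_mul ε)))
          (hint (by fun_prop))
          ((show ∀ᵐ p ∂(μ.prod ν), p ∈ K ×ˢ K from mem_ae_iff.2 (prod_compl_null hμ hν)).mono hpt)
    _ = dualValue c ε μ ν f g + ε * ((3 * κ) ^ 2 / b) := by
        rw [integral_add (hint (by fun_prop)) (integrable_const _),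
          integral_sub (hint (by fun_prop)) (hint (by fun_prop)), integral_const_mul,
          integral_density_mul_add hK hμ hν hf hg hD hD₁ hD₂, integral_const, probReal_univ,
          one_smul, dualValue]

end Duality

section Oscillation

/-- The oscillation `sup u - inf u` of `u` is at most `δ`. -/
def OscLE {Y : Type*} (u : Y → ℝ) (δ : ℝ) : Prop := ∀ y y', u y - u y' ≤ δ

variable {Y : Type*} {u : Y → ℝ} {δ δ' : ℝ}

lemma OscLE.mono (h : OscLE u δ) (hδ : δ ≤ δ') : OscLE u δ' := fun y y' => (h y y').trans hδ

lemma OscLE.nonneg [Nonempty Y] (h : OscLE u δ) : 0 ≤ δ := by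
  simpa using h (Classical.arbitrary Y) (Classical.arbitrary Y)

lemma OscLE.abs_apply_le (h : OscLE u δ) {y₀ : Y} (hy₀ : u y₀ = 0) (y : Y) : |u y| ≤ δ := by
  have h₁ := h y y₀
  have h₂ := h y₀ y
  rw [hy₀] at h₁ h₂
  exact abs_le.2 ⟨by linarith, by linarith⟩

lemma mix_exp_le {κ δ R : ℝ} (hκ : 0 ≤ κ) (hδ : 0 ≤ δ) (hR : δ ≤ R) :
    (1 - κ) * Real.exp δ + κ ≤ Real.exp ((1 - κ / (1 + R)) * δ) := by
  have hR1 : 0 < 1 + R := by linarith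
  have hδexp : δ * Real.exp δ ≤ (Real.exp δ - 1) * (1 + R) := by
    calc δ * Real.exp δ ≤ (Real.exp δ - 1) * (1 + δ) := by linarith [Real.add_one_le_exp δ]
      _ ≤ (Real.exp δ - 1) * (1 + R) := by
          gcongr
          exact sub_nonneg.2 (Real.one_le_exp hδ)
  calc (1 - κ) * Real.exp δ + κ = Real.exp δ - κ * (Real.exp δ - 1) := by ring
    _ ≤ Real.exp δ - κ * (δ * Real.exp δ / (1 + R)) := by
        gcongr
        rwa [div_le_iff₀ hR1]
    _ = Real.exp δ * (-(κ / (1 + R) * δ) + 1) := by field_simp; ring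
    _ ≤ Real.exp δ * Real.exp (-(κ / (1 + R) * δ)) := by
        gcongr
        exact Real.add_one_le_exp _
    _ = Real.exp ((1 - κ / (1 + R)) * δ) := by rw [← Real.exp_add]; ring_nf

variable [MeasurableSpace Y]

lemma integral_exp_le_of_smul_le {P P' : Measure Y} [IsProbabilityMeasure P]
    [IsProbabilityMeasure P'] {κ R : ℝ} (hκ₀ : 0 ≤ κ) (hκ₁ : κ ≤ 1)
    (hPP' : ENNReal.ofReal κ • P' ≤ P) (hu : OscLE u δ) (hR : δ ≤ R)
    (hP : Integrable (fun y => Real.exp (u y)) P) (hP' : Integrable (fun y => Real.exp (u y)) P') :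
    ∫ y, Real.exp (u y) ∂P ≤
      Real.exp ((1 - κ / (1 + R)) * δ) * ∫ y, Real.exp (u y) ∂P' := by
  have : Nonempty Y := nonempty_of_isProbabilityMeasure P
  have hbdd : BddAbove (range u) :=
    ⟨u (Classical.arbitrary Y) + δ, by rintro _ ⟨y, rfl⟩; linarith [hu y (Classical.arbitrary Y)]⟩
  set N := ⨆ y, u y
  have hmax : Real.exp N ≤ Real.exp δ * ∫ y, Real.exp (u y) ∂P' := by
    rw [← integral_const_mul]
    calc Real.exp N = ∫ _, Real.exp N ∂P' := by simp
      _ ≤ ∫ y, Real.exp δ * Real.exp (u y) ∂P' :=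
        integral_mono (integrable_const _) (hP'.const_mul _) fun y => by
          rw [← Real.exp_add]
          exact Real.exp_le_exp.2 (ciSup_le fun y' => by linarith [hu y' y])
  have hminor : κ * (Real.exp N - ∫ y, Real.exp (u y) ∂P') ≤
      Real.exp N - ∫ y, Real.exp (u y) ∂P := by
    have h := integral_mono_measure hPP' (f := fun y => Real.exp N - Real.exp (u y))
      (.of_forall fun y => sub_nonneg.2 (Real.exp_le_exp.2 (le_ciSup hbdd y)))
      ((integrable_const _).sub hP)
    rw [integral_smul_measure, integral_sub (integrable_const _) hP,
      integral_sub (integrable_const _) hP', ENNReal.toReal_ofReal hκ₀] at h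
    simpa using h
  calc ∫ y, Real.exp (u y) ∂P
      ≤ (1 - κ) * Real.exp N + κ * ∫ y, Real.exp (u y) ∂P' := by linarith
    _ ≤ (1 - κ) * (Real.exp δ * ∫ y, Real.exp (u y) ∂P') + κ * ∫ y, Real.exp (u y) ∂P' := by
        gcongr
    _ = ((1 - κ) * Real.exp δ + κ) * ∫ y, Real.exp (u y) ∂P' := by ring
    _ ≤ _ := mul_le_mul_of_nonneg_right (mix_exp_le hκ₀ hu.nonneg hR)
        (integral_nonneg fun y => (Real.exp_pos _).le)

lemma smul_tilted_le_tilted {ν : Measure Y} {v v' : Y → ℝ} {b : ℝ}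
    (hv : Integrable (fun y => Real.exp (v y)) ν) (hv' : Integrable (fun y => Real.exp (v' y)) ν)
    (h : ∀ y, |v y - v' y| ≤ b) :
    ENNReal.ofReal (Real.exp (-(2 * b))) • ν.tilted v' ≤ ν.tilted v := by
  rcases eq_zero_or_neZero ν with rfl | _
  · simp
  have hZ := integral_exp_pos hv
  have hZ' := integral_exp_pos hv'
  have hZZ' : ∫ y, Real.exp (v y) ∂ν ≤ Real.exp b * ∫ y, Real.exp (v' y) ∂ν := by
    rw [← integral_const_mul]
    refine integral_mono hv (hv'.const_mul _) fun y => ?_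
    rw [← Real.exp_add]
    exact Real.exp_le_exp.2 (by linarith [(abs_le.1 (h y)).2])
  rw [Measure.tilted, Measure.tilted, ← withDensity_smul' _ _ ENNReal.ofReal_ne_top]
  refine withDensity_mono (.of_forall fun y => ?_)
  rw [Pi.smul_apply, smul_eq_mul, ← ENNReal.ofReal_mul (Real.exp_pos _).le]
  refine ENNReal.ofReal_le_ofReal ?_
  have hvv' : Real.exp (v' y) ≤ Real.exp b * Real.exp (v y) := by
    rw [← Real.exp_add]
    exact Real.exp_le_exp.2 (by linarith [(abs_le.1 (h y)).1])
  have hexp : Real.exp (-(2 * b)) * (Real.exp b * Real.exp b) = 1 := by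
    rw [← Real.exp_add, ← Real.exp_add, Real.exp_eq_one_iff]; ring
  rw [← mul_div_assoc, div_le_div_iff₀ hZ' hZ]
  calc Real.exp (-(2 * b)) * Real.exp (v' y) * ∫ y, Real.exp (v y) ∂ν
      ≤ Real.exp (-(2 * b)) * (Real.exp b * Real.exp (v y)) *
          (Real.exp b * ∫ y, Real.exp (v' y) ∂ν) := by gcongr
    _ = Real.exp (-(2 * b)) * (Real.exp b * Real.exp b) *
          (Real.exp (v y) * ∫ y, Real.exp (v' y) ∂ν) := by ring
    _ = Real.exp (v y) * ∫ y, Real.exp (v' y) ∂ν := by rw [hexp, one_mul]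

lemma log_integral_exp_le {ν : Measure Y} [NeZero ν] {v v' : Y → ℝ} {a : ℝ}
    (hv : Integrable (fun y => Real.exp (v y)) ν) (hv' : Integrable (fun y => Real.exp (v' y)) ν)
    (h : ∀ y, v y ≤ v' y + a) :
    Real.log (∫ y, Real.exp (v y) ∂ν) ≤ Real.log (∫ y, Real.exp (v' y) ∂ν) + a := by
  rw [← Real.log_exp a, ← Real.log_mul (integral_exp_pos hv').ne' (Real.exp_pos a).ne',
    ← integral_mul_const]
  refine Real.log_le_log (integral_exp_pos hv) (integral_mono hv (hv'.mul_const _) fun y => ?_)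
  rw [← Real.exp_add]
  exact Real.exp_le_exp.2 (h y)

end Oscillation

section SoftTransform

/-- The soft `c`-transform of `g` with respect to `ν`; one step of Sinkhorn's algorithm, for the
regularization parameter `1`. -/
noncomputable def softTransform {X Y : Type*} [MeasurableSpace Y] (c : X → Y → ℝ) (ν : Measure Y)
    (g : Y → ℝ) (x : X) : ℝ :=
  -Real.log (∫ y, Real.exp (g y - c x y) ∂ν)

variable {X Y : Type*} [MeasurableSpace Y] {c : X → Y → ℝ} {ν : Measure Y} {g g' : Y → ℝ}

lemma softTransform_le [NeZero ν] (hg : ∀ x, Integrable (fun y => Real.exp (g y - c x y)) ν)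
    (hg' : ∀ x, Integrable (fun y => Real.exp (g' y - c x y)) ν) {a : ℝ}
    (h : ∀ y, g' y ≤ g y + a) (x : X) : softTransform c ν g x ≤ softTransform c ν g' x + a := by
  have := log_integral_exp_le (hg' x) (hg x) (a := a) fun y => by linarith [h y]
  simp only [softTransform]
  linarith

lemma oscLE_softTransform [NeZero ν] (hg : ∀ x, Integrable (fun y => Real.exp (g y - c x y)) ν)
    {B : ℝ} (hB : ∀ x y, |c x y| ≤ B) : OscLE (softTransform c ν g) (2 * B) := fun x x' => by
  have := log_integral_exp_le (hg x') (hg x) (a := 2 * B) fun y => by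
    linarith [(abs_le.1 (hB x y)).2, (abs_le.1 (hB x' y)).1]
  simp only [softTransform]
  linarith

lemma integral_exp_softTransform [NeZero ν] {x : X}
    (hg : Integrable (fun y => Real.exp (g y - c x y)) ν) :
    ∫ y, Real.exp (softTransform c ν g x + g y - c x y) ∂ν = 1 := by
  simp_rw [add_sub_assoc, Real.exp_add]
  rw [integral_const_mul, softTransform, Real.exp_neg, Real.exp_log (integral_exp_pos hg),
    inv_mul_cancel₀ (integral_exp_pos hg).ne']

lemma softTransform_sub_softTransform [NeZero ν] {x : X}
    (hg : Integrable (fun y => Real.exp (g y - c x y)) ν)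
    (hg' : Integrable (fun y => Real.exp (g' y - c x y)) ν) :
    softTransform c ν g x - softTransform c ν g' x =
      Real.log (∫ y, Real.exp (g' y - g y) ∂(ν.tilted fun y => g y - c x y)) := by
  rw [integral_exp_tilted]
  have h : ∀ y, ((fun y => g y - c x y) + fun y => g' y - g y) y = g' y - c x y := fun y => by
    simp only [Pi.add_apply]; ring
  simp_rw [h]
  rw [Real.log_div (integral_exp_pos hg').ne' (integral_exp_pos hg).ne', softTransform,
    softTransform]
  ring

lemma integrable_exp_tilted {v v' : Y → ℝ} (hv : Integrable (fun y => Real.exp (v y)) ν)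
    (hv' : Integrable (fun y => Real.exp (v' y)) ν) :
    Integrable (fun y => Real.exp (v' y - v y)) (ν.tilted v) := by
  rw [integrable_tilted_iff hv]
  simpa only [smul_eq_mul, ← Real.exp_add, add_sub_cancel] using hv'

/-- Doeblin's argument: the Gibbs measures at `x` and `x'` share a component of mass `e^(-4B)`. -/
lemma OscLE.softTransform_sub [NeZero ν] (hg : ∀ x, Integrable (fun y => Real.exp (g y - c x y)) ν)
    (hg' : ∀ x, Integrable (fun y => Real.exp (g' y - c x y)) ν) {B R δ : ℝ} (hB₀ : 0 ≤ B)
    (hB : ∀ x y, |c x y| ≤ B) (hR : δ ≤ R) (h : OscLE (fun y => g' y - g y) δ) :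
    OscLE (fun x => softTransform c ν g x - softTransform c ν g' x)
      ((1 - Real.exp (-(4 * B)) / (1 + R)) * δ) := by
  intro x x'
  let P (x : X) : Measure Y := ν.tilted fun y => g y - c x y
  have (x : X) : IsProbabilityMeasure (P x) := isProbabilityMeasure_tilted (hg x)
  have hint (x : X) : Integrable (fun y => Real.exp (g' y - g y)) (P x) := by
    simpa only [sub_sub_sub_cancel_right] using integrable_exp_tilted (hg x) (hg' x)
  have hminor : ENNReal.ofReal (Real.exp (-(4 * B))) • P x' ≤ P x := by
    convert smul_tilted_le_tilted (b := 2 * B) (hg x) (hg x') fun y => ?_ using 4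
    · ring
    · rw [sub_sub_sub_cancel_left, two_mul]
      exact (abs_sub _ _).trans (add_le_add (hB x' y) (hB x y))
  have hexp := integral_exp_le_of_smul_le (Real.exp_pos _).le (Real.exp_le_one_iff.2 (by linarith))
    hminor h hR (hint x) (hint x')
  have hlog := Real.log_le_log (integral_exp_pos (hint x)) hexp
  rw [Real.log_mul (Real.exp_pos _).ne' (integral_exp_pos (hint x')).ne', Real.log_exp] at hlog
  simp only [softTransform_sub_softTransform (hg _) (hg' _)]
  linarith

end SoftTransform

section FixedPoint

variable {Y : Type*} [TopologicalSpace Y] [CompactSpace Y]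

lemma exists_eq_add_const_of_contracting_oscLE [Nonempty Y] {S : C(Y, ℝ) → C(Y, ℝ)}
    (hS : Continuous S) {q R : ℝ} (hq₀ : 0 ≤ q) (hq₁ : q < 1) (hR : ∀ g, OscLE (S g) R)
    (hcontr : ∀ g g' δ, δ ≤ R → OscLE (fun y => g' y - g y) δ →
      OscLE (fun y => S g' y - S g y) (q * δ)) :
    ∃ (g : C(Y, ℝ)) (a : ℝ), ∀ y, S g y = g y + a := by
  let y₀ : Y := Classical.arbitrary Y
  have hR₀ : 0 ≤ R := (hR 0).nonneg
  let S₀ : C(Y, ℝ) → C(Y, ℝ) := fun g => S g - ContinuousMap.const Y (S g y₀)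
  have hS₀ : Continuous S₀ :=
    hS.sub (ContinuousMap.continuous_const'.comp ((continuous_eval_const y₀).comp hS))
  let u : ℕ → C(Y, ℝ) := fun n => S₀^[n] 0
  have hu : ∀ n, u (n + 1) = S₀ (u n) := fun n => Function.iterate_succ_apply' S₀ n 0
  have hu₀ : ∀ n, u n y₀ = 0 := fun n => by
    cases n with
    | zero => rfl
    | succ n => rw [hu]; exact sub_self _
  have hosc : ∀ n, OscLE (fun y => u (n + 1) y - u n y) (R * q ^ n) := by
    intro n
    induction n with
    | zero => simpa [OscLE, u, S₀] using hR 0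
    | succ n ih =>
      have hδ : R * q ^ n ≤ R := mul_le_of_le_one_right hR₀ (pow_le_one₀ hq₀ hq₁.le)
      refine OscLE.mono (δ := q * (R * q ^ n)) (fun y y' => ?_) (by rw [pow_succ]; linarith)
      have := hcontr _ _ _ hδ ih y y'
      rw [hu (n + 1), hu n] at *
      simp only [S₀, ContinuousMap.sub_apply, ContinuousMap.const_apply] at *
      linarith
  have hdist : ∀ n, dist (u n) (u (n + 1)) ≤ R * q ^ n := fun n => by
    rw [ContinuousMap.dist_le (by positivity)]
    intro y
    rw [dist_comm, Real.dist_eq]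
    exact (hosc n).abs_apply_le (y₀ := y₀) (by simp only [hu₀, sub_self]) y
  obtain ⟨g, hg⟩ := cauchySeq_tendsto_of_complete (cauchySeq_of_le_geometric q R hq₁ hdist)
  have hfix : S₀ g = g := tendsto_nhds_unique
    (by simpa only [hu, Function.comp_def] using (hS₀.tendsto g).comp hg)
    ((tendsto_add_atTop_iff_nat 1).2 hg)
  exact ⟨g, S g y₀, fun y => by
    simpa [S₀, sub_eq_iff_eq_add] using DFunLike.congr_fun hfix y⟩

end FixedPoint

section CompactSinkhorn

variable {X Y : Type*} [TopologicalSpace X] [TopologicalSpace Y] [CompactSpace Y]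
  [MeasurableSpace Y] [OpensMeasurableSpace Y] {c : X → Y → ℝ}
  (ν : Measure Y) [IsProbabilityMeasure ν]

lemma integrable_exp_sub_cost (hc : Continuous fun p : X × Y => c p.1 p.2) (g : C(Y, ℝ)) (x : X) :
    Integrable (fun y => Real.exp (g y - c x y)) ν :=
  Continuous.integrable_of_hasCompactSupport
    (Real.continuous_exp.comp (g.continuous.sub (hc.comp (.prodMk_right x))))
    (.of_compactSpace _)

variable [CompactSpace X] [T2Space X] [FirstCountableTopology X]

/-- The soft `c`-transform as a map between spaces of continuous functions. -/
noncomputable def softTransformMap (hc : Continuous fun p : X × Y => c p.1 p.2) (g : C(Y, ℝ)) :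
    C(X, ℝ) where
  toFun := softTransform c ν g
  continuous_toFun := by
    have h := continuous_parametric_integral_of_continuous (μ := ν)
      (f := fun x y => Real.exp (g y - c x y))
      (Real.continuous_exp.comp ((g.continuous.comp continuous_snd).sub hc)) isCompact_univ
    rw [Measure.restrict_univ] at h
    exact (h.log fun x => (integral_exp_pos (integrable_exp_sub_cost ν hc g x)).ne').neg

lemma dist_softTransformMap_le (hc : Continuous fun p : X × Y => c p.1 p.2) (g g' : C(Y, ℝ)) :
    dist (softTransformMap ν hc g) (softTransformMap ν hc g') ≤ dist g g' := by
  have h : ∀ g g' : C(Y, ℝ), ∀ x,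
      softTransform c ν g x ≤ softTransform c ν g' x + dist g g' := fun g g' =>
    softTransform_le (integrable_exp_sub_cost ν hc g) (integrable_exp_sub_cost ν hc g') fun y => by
      linarith [(abs_le.1 (Real.dist_eq (g y) (g' y) ▸ ContinuousMap.dist_apply_le_dist y)).1]
  rw [ContinuousMap.dist_le dist_nonneg]
  intro x
  rw [Real.dist_eq]
  exact abs_sub_le_iff.2 ⟨sub_le_iff_le_add'.2 (h g g' x),
    sub_le_iff_le_add'.2 (dist_comm g' g ▸ h g' g x)⟩

variable [MeasurableSpace X] [OpensMeasurableSpace X] [T2Space Y]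
  [FirstCountableTopology Y] (μ : Measure X) [IsProbabilityMeasure μ]

lemma exists_softTransform_eq_add_const (hc : Continuous fun p : X × Y => c p.1 p.2) :
    ∃ (f : C(X, ℝ)) (g : C(Y, ℝ)) (a : ℝ), (∀ x, f x = softTransform c ν g x) ∧
      ∀ y, g y + a = softTransform (Function.swap c) μ f y := by
  have : Nonempty X := nonempty_of_isProbabilityMeasure μ
  have : Nonempty Y := nonempty_of_isProbabilityMeasure ν
  have hc' : Continuous fun p : Y × X => Function.swap c p.1 p.2 := hc.comp continuous_swap
  obtain ⟨B, hB⟩ := (isCompact_range hc).isBounded.exists_norm_le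
  replace hB : ∀ x y, |c x y| ≤ B := fun x y => hB _ (mem_range_self (x, y))
  have hB₀ : 0 ≤ B := (abs_nonneg _).trans (hB (Classical.arbitrary X) (Classical.arbitrary Y))
  set q := 1 - Real.exp (-(4 * B)) / (1 + 2 * B)
  have hq₁ : q < 1 := sub_lt_self _ (by positivity)
  have hq₀ : 0 ≤ q := sub_nonneg.2 ((div_le_one (by positivity)).2
    (by linarith [Real.exp_le_one_iff.2 (by linarith : -(4 * B) ≤ 0)]))
  let T := softTransformMap ν hc
  let T' := softTransformMap μ hc'
  have hcont : Continuous (T' ∘ T) := LipschitzWith.continuous (K := 1)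
    (.of_dist_le_mul fun g g' => by
      simpa using (dist_softTransformMap_le μ hc' _ _).trans (dist_softTransformMap_le ν hc g g'))
  have hcontr : ∀ g g' δ, δ ≤ 2 * B → OscLE (fun y => g' y - g y) δ →
      OscLE (fun y => (T' ∘ T) g' y - (T' ∘ T) g y) (q * δ) := fun g g' δ hδ h => by
    have hδ₀ : 0 ≤ δ := h.nonneg
    have h₁ : OscLE (fun x => T g x - T g' x) (q * δ) := h.softTransform_sub
      (integrable_exp_sub_cost ν hc g) (integrable_exp_sub_cost ν hc g') hB₀ hB hδ
    have hqδ : q * δ ≤ δ := mul_le_of_le_one_left hδ₀ hq₁.le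
    have h₂ := h₁.softTransform_sub (integrable_exp_sub_cost μ hc' (T g'))
      (integrable_exp_sub_cost μ hc' (T g)) hB₀ (fun y x => hB x y) (hqδ.trans hδ)
    exact h₂.mono (mul_le_mul_of_nonneg_left hqδ hq₀)
  obtain ⟨g, a, hga⟩ := exists_eq_add_const_of_contracting_oscLE hcont hq₀ hq₁
    (fun g => oscLE_softTransform (integrable_exp_sub_cost μ hc' (T g)) fun y x => hB x y) hcontr
  exact ⟨T g, g, a, fun _ => rfl, fun y => (hga y).symm⟩

/-- The constant in `exists_softTransform_eq_add_const` vanishes since `exp (f + g - c)` has the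
same total mass in both orders of integration. -/
lemma exists_eq_softTransform (hc : Continuous fun p : X × Y => c p.1 p.2) :
    ∃ (f : C(X, ℝ)) (g : C(Y, ℝ)), (∀ x, f x = softTransform c ν g x) ∧
      ∀ y, g y = softTransform (Function.swap c) μ f y := by
  have hc' : Continuous fun p : Y × X => Function.swap c p.1 p.2 := hc.comp continuous_swap
  obtain ⟨f, g, a, hf, hg⟩ := exists_softTransform_eq_add_const ν μ hc
  have hν : ∀ x, ∫ y, Real.exp (f x + g y - c x y) ∂ν = 1 := fun x => by
    simpa only [hf x] using integral_exp_softTransform (integrable_exp_sub_cost ν hc g x)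
  have hμ : ∀ y, ∫ x, Real.exp (f x + g y - c x y) ∂μ = Real.exp (-a) := fun y => by
    have h := integral_exp_softTransform (integrable_exp_sub_cost μ hc' f y)
    have hsplit : ∀ x, Real.exp (f x + g y - c x y) =
        Real.exp (-a) * Real.exp (g y + a + f x - Function.swap c y x) := fun x => by
      rw [← Real.exp_add, Function.swap]; ring_nf
    simp_rw [hsplit, hg y]
    rw [integral_const_mul, h, mul_one]
  have hswap := integral_integral_swap_of_hasCompactSupport (μ := μ) (ν := ν)
    (f := fun x y => Real.exp (f x + g y - c x y))
    (by simp only [Function.uncurry_def]; fun_prop) (.of_compactSpace _)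
  have ha : a = 0 := by simpa [hν, hμ] using hswap.symm
  exact ⟨f, g, hf, fun y => by rw [← hg, ha, add_zero]⟩

end CompactSinkhorn

section Smoothing

variable {V F : Type*} [NormedAddCommGroup V] [NormedSpace ℝ V] [FiniteDimensional ℝ V]
  [NormedAddCommGroup F] [NormedSpace ℝ F] {u : V → F} {K : Set V} {η : ℝ}

lemma exists_hasCompactSupport_eventuallyEq {n : ℕ∞} (hu : ContDiff ℝ n u) (hK : IsCompact K) :
    ∃ v : V → F, ContDiff ℝ n v ∧ HasCompactSupport v ∧ ∀ x ∈ K, v =ᶠ[𝓝 x] u := by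
  obtain ⟨r, hr₀, hr⟩ := hK.isBounded.subset_ball_lt 0 0
  let χ : ContDiffBump (0 : V) := ⟨r, r + 1, hr₀, by linarith⟩
  refine ⟨fun x => χ x • u x, χ.contDiff.smul hu, χ.hasCompactSupport.smul_right, fun x hx => ?_⟩
  filter_upwards [Metric.isOpen_ball.mem_nhds (hr hx)] with y hy
  rw [χ.one_of_mem_closedBall (Metric.ball_subset_closedBall hy), one_smul]

variable [CompleteSpace F]

lemma exists_contDiff_approx_of_hasCompactSupport (hu : ContDiff ℝ 1 u)
    (hsupp : HasCompactSupport u) (hη : 0 < η) :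
    ∃ h : V → F, ContDiff ℝ ∞ h ∧ HasCompactSupport h ∧
      ∀ x, ‖u x - h x‖ ≤ η ∧ ‖fderiv ℝ u x - fderiv ℝ h x‖ ≤ η := by
  borelize V
  let m : Measure V := Measure.addHaar
  have hdc : Continuous (fderiv ℝ u) := hu.continuous_fderiv one_ne_zero
  obtain ⟨δ₁, hδ₁, hu₁⟩ := Metric.uniformContinuous_iff.1
    (hsupp.uniformContinuous_of_continuous hu.continuous) η hη
  obtain ⟨δ₂, hδ₂, hu₂⟩ := Metric.uniformContinuous_iff.1
    ((hsupp.fderiv ℝ).uniformContinuous_of_continuous hdc) η hη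
  have hδ : 0 < min δ₁ δ₂ := lt_min hδ₁ hδ₂
  let ρ : ContDiffBump (0 : V) := ⟨min δ₁ δ₂ / 2, min δ₁ δ₂, by linarith, by linarith⟩
  refine ⟨convolution (ρ.normed m) u (ContinuousLinearMap.lsmul ℝ ℝ) m,
    ρ.hasCompactSupport_normed.contDiff_convolution_left _ ρ.contDiff_normed
      hu.continuous.locallyIntegrable,
    ρ.hasCompactSupport_normed.convolution _ hsupp, fun x => ⟨?_, ?_⟩⟩
  · rw [← dist_eq_norm, dist_comm]
    exact ρ.dist_normed_convolution_le hu.continuous.aestronglyMeasurable fun y hy =>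
      (hu₁ ((Metric.mem_ball.1 hy).trans_le (min_le_left _ _))).le
  · have hderiv := hsupp.hasFDerivAt_convolution_right (μ := m) (ContinuousLinearMap.lsmul ℝ ℝ)
      (f := ρ.normed m) ρ.continuous_normed.locallyIntegrable hu x
    have hconv : convolution (ρ.normed m) (fderiv ℝ u)
        ((ContinuousLinearMap.lsmul ℝ ℝ).precompR V) m x
        = convolution (ρ.normed m) (fderiv ℝ u) (ContinuousLinearMap.lsmul ℝ ℝ) m x := by
      refine integral_congr_ae (ae_of_all _ fun y => ?_)
      ext z
      simp [ContinuousLinearMap.precompR_apply]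
    rw [hderiv.fderiv, hconv, ← dist_eq_norm, dist_comm]
    exact ρ.dist_normed_convolution_le hdc.aestronglyMeasurable fun y hy =>
      (hu₂ ((Metric.mem_ball.1 hy).trans_le (min_le_right _ _))).le

lemma exists_contDiff_hasCompactSupport_approx (hu : ContDiff ℝ 1 u) (hK : IsCompact K)
    (hη : 0 < η) : ∃ h : V → F, ContDiff ℝ ∞ h ∧ HasCompactSupport h ∧
      ∀ x ∈ K, ‖u x - h x‖ ≤ η ∧ ‖fderiv ℝ u x - fderiv ℝ h x‖ ≤ η := by
  obtain ⟨v, hv, hsupp, hvu⟩ := exists_hasCompactSupport_eventuallyEq hu hK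
  obtain ⟨h, hh, hhsupp, hhv⟩ := exists_contDiff_approx_of_hasCompactSupport hv hsupp hη
  refine ⟨h, hh, hhsupp, fun x hx => ?_⟩
  rw [← (hvu x hx).self_of_nhds, ← (hvu x hx).fderiv_eq]
  exact hhv x

lemma exists_bound_norm_fderiv {V F : Type*} [NormedAddCommGroup V] [NormedSpace ℝ V]
    [NormedAddCommGroup F] [NormedSpace ℝ F] {u : V → F} {K : Set V} (hu : ContDiff ℝ 1 u)
    (hK : IsCompact K) : ∃ B, 0 < B ∧ ∀ x ∈ K, ‖u x‖ ≤ B ∧ ‖fderiv ℝ u x‖ ≤ B := by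
  obtain ⟨B₀, hB₀⟩ := hK.exists_bound_of_continuousOn hu.continuous.continuousOn
  obtain ⟨B₁, hB₁⟩ := hK.exists_bound_of_continuousOn
    (hu.continuous_fderiv one_ne_zero).continuousOn
  exact ⟨max 1 (max B₀ B₁), by positivity, fun x hx => ⟨(hB₀ x hx).trans (by simp),
    (hB₁ x hx).trans (by simp)⟩⟩

end Smoothing

section PartialDerivatives

variable {V W F : Type*} [NormedAddCommGroup V] [NormedSpace ℝ V] [NormedAddCommGroup W]
  [NormedSpace ℝ W] [NormedAddCommGroup F] [NormedSpace ℝ F] {G : V → W → F} {x : V} {y : W}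

lemma hasFDerivAt_uncurry_left (hG : DifferentiableAt ℝ (Function.uncurry G) (x, y)) :
    HasFDerivAt (fun x => G x y)
      ((fderiv ℝ (Function.uncurry G) (x, y)).comp (.inl ℝ V W)) x :=
  HasFDerivAt.comp (g := Function.uncurry G) (f := fun x => (x, y)) x hG.hasFDerivAt
    (hasFDerivAt_prodMk_left x y)

lemma hasFDerivAt_uncurry_right (hG : DifferentiableAt ℝ (Function.uncurry G) (x, y)) :
    HasFDerivAt (G x) ((fderiv ℝ (Function.uncurry G) (x, y)).comp (.inr ℝ V W)) y :=
  hG.hasFDerivAt.comp y (hasFDerivAt_prodMk_right x y)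

lemma norm_fderiv_left_le (hG : DifferentiableAt ℝ (Function.uncurry G) (x, y)) :
    ‖fderiv ℝ (fun x => G x y) x‖ ≤ ‖fderiv ℝ (Function.uncurry G) (x, y)‖ := by
  rw [(hasFDerivAt_uncurry_left hG).fderiv]
  exact (ContinuousLinearMap.opNorm_comp_le _ _).trans (mul_le_of_le_one_right (norm_nonneg _)
    (ContinuousLinearMap.norm_inl_le_one ℝ V W))

lemma norm_fderiv_right_le (hG : DifferentiableAt ℝ (Function.uncurry G) (x, y)) :
    ‖fderiv ℝ (G x) y‖ ≤ ‖fderiv ℝ (Function.uncurry G) (x, y)‖ := by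
  rw [(hasFDerivAt_uncurry_right hG).fderiv]
  exact (ContinuousLinearMap.opNorm_comp_le _ _).trans (mul_le_of_le_one_right (norm_nonneg _)
    (ContinuousLinearMap.norm_inr_le_one ℝ V W))

lemma continuous_fderiv_left (hG : ContDiff ℝ 1 (Function.uncurry G)) :
    Continuous fun p : V × W => fderiv ℝ (fun x => G x p.2) p.1 := by
  simp_rw [(hasFDerivAt_uncurry_left (hG.differentiable one_ne_zero _)).fderiv]
  exact (hG.continuous_fderiv one_ne_zero).clm_comp continuous_const

end PartialDerivatives

section ParametricIntegral

variable {V W F : Type*} [NormedAddCommGroup V] [NormedSpace ℝ V] [FiniteDimensional ℝ V]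
  [TopologicalSpace W] [T2Space W] [SecondCountableTopology W] [MeasurableSpace W]
  [OpensMeasurableSpace W] [NormedAddCommGroup F] [NormedSpace ℝ F] {G : V → W → F}
  {ν : Measure W} [IsFiniteMeasure ν] {K : Set W}

lemma hasFDerivAt_integral_of_compl_null (hK : IsCompact K) (hν : ν Kᶜ = 0)
    (hG : ∀ x, Continuous (G x)) (hd : ∀ y, Differentiable ℝ fun x => G x y)
    (hG' : Continuous fun p : V × W => fderiv ℝ (fun x => G x p.2) p.1) (x : V) :
    HasFDerivAt (fun x => ∫ y, G x y ∂ν) (∫ y, fderiv ℝ (fun x => G x y) x ∂ν) x := by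
  obtain ⟨M, hM⟩ := ((isCompact_closedBall x 1).prod hK).exists_bound_of_continuousOn
    hG'.continuousOn
  refine hasFDerivAt_integral_of_dominated_of_fderiv_le (s := Metric.closedBall x 1)
    (bound := fun _ => M) (Metric.closedBall_mem_nhds x one_pos)
    (.of_forall fun z => (hG z).aestronglyMeasurable)
    (integrable_of_continuousOn_of_compl_null hK hν (hG x).continuousOn)
    (hG'.comp (.prodMk_right x)).aestronglyMeasurable
    ?_ (integrable_const M) (ae_of_all _ fun y z _ => (hd y z).hasFDerivAt)
  filter_upwards [mem_ae_iff.2 hν] with y hy z hz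
  exact hM (z, y) ⟨hz, hy⟩

lemma contDiff_integral_of_compl_null (hK : IsCompact K) (hν : ν Kᶜ = 0)
    (hG : ∀ x, Continuous (G x)) (hd : ∀ y, Differentiable ℝ fun x => G x y)
    (hG' : Continuous fun p : V × W => fderiv ℝ (fun x => G x p.2) p.1) :
    ContDiff ℝ 1 fun x => ∫ y, G x y ∂ν :=
  contDiff_one_iff_hasFDerivAt.2 ⟨_,
    continuous_integral_of_compl_null hK hν (h := fun x y => fderiv ℝ (fun x => G x y) x) hG',
    hasFDerivAt_integral_of_compl_null hK hν hG hd hG'⟩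

end ParametricIntegral

lemma eventually_mul_le {B η : ℝ} (hB : 0 < B) (hη : 0 < η) :
    ∀ᶠ r in 𝓝[≥] (0 : ℝ), 0 ≤ r ∧ r * B ≤ η := by
  filter_upwards [Icc_mem_nhdsGE (div_pos hη hB)] with r hr
  exact ⟨hr.1, (le_div_iff₀ hB).1 hr.2⟩

section DualClose

variable {V F : Type*} [NormedAddCommGroup V] [NormedSpace ℝ V] [MeasurableSpace V] {K : Set V}
  {r : ℝ} {μ ν μ₀ ν₀ : Measure V}

/-- The measure `μ` is a probability measure on `K` at distance at most `r` from `μ₀` in the dual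
of the `C¹` norm on `K`. -/
structure DualClose (K : Set V) (r : ℝ) (μ μ₀ : Measure V) : Prop where
  isProbabilityMeasure : IsProbabilityMeasure μ
  compl_null : μ Kᶜ = 0
  abs_integral_sub_le : ∀ (h : V → ℝ) (B : ℝ), ContDiff ℝ 1 h → (∀ x ∈ K, |h x| ≤ B) →
    (∀ x ∈ K, ‖fderiv ℝ h x‖ ≤ B) → |∫ x, h x ∂μ - ∫ x, h x ∂μ₀| ≤ r * B

lemma DualClose.self [IsProbabilityMeasure μ] (hμ : μ Kᶜ = 0) (hr : 0 ≤ r) :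
    DualClose K r μ μ := by
  refine ⟨inferInstance, hμ, fun h B _ hB _ => ?_⟩
  obtain ⟨x, hx⟩ := (show ∀ᵐ x ∂μ, x ∈ K from mem_ae_iff.2 hμ).exists
  simpa using mul_nonneg hr ((abs_nonneg _).trans (hB x hx))

lemma DualClose.mono_set (h : DualClose K r μ μ₀) {L : Set V} (hKL : K ⊆ L) :
    DualClose L r μ μ₀ :=
  ⟨h.isProbabilityMeasure, measure_mono_null (compl_subset_compl.2 hKL) h.compl_null,
    fun u B hu hB hB' => h.abs_integral_sub_le u B hu (fun x hx => hB x (hKL hx))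
      fun x hx => hB' x (hKL hx)⟩

variable [FiniteDimensional ℝ V] [OpensMeasurableSpace V] [NormedAddCommGroup F] [NormedSpace ℝ F]
  [CompleteSpace F]

lemma DualClose.norm_integral_sub_le [IsFiniteMeasure μ₀] (hK : IsCompact K) (hμ₀ : μ₀ Kᶜ = 0)
    (h : DualClose K r μ μ₀) {q : V → F} (hq : ContDiff ℝ 1 q) {B : ℝ} (hrB : 0 ≤ r * B)
    (hB : ∀ x ∈ K, ‖q x‖ ≤ B) (hB' : ∀ x ∈ K, ‖fderiv ℝ q x‖ ≤ B) :
    ‖∫ x, q x ∂μ - ∫ x, q x ∂μ₀‖ ≤ r * B := by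
  have := h.isProbabilityMeasure
  refine NormedSpace.norm_le_dual_bound ℝ _ hrB fun ℓ => ?_
  have hℓ (x : V) : HasFDerivAt (fun x => ℓ (q x)) (ℓ.comp (fderiv ℝ q x)) x :=
    ℓ.hasFDerivAt.comp x (hq.differentiable one_ne_zero x).hasFDerivAt
  have key := h.abs_integral_sub_le (fun x => ℓ (q x)) (‖ℓ‖ * B) (ℓ.contDiff.comp hq)
    (fun x hx => ℓ.le_opNorm_of_le (hB x hx)) fun x hx => by
      rw [(hℓ x).fderiv]
      exact (ℓ.opNorm_comp_le _).trans (mul_le_mul_of_nonneg_left (hB' x hx) (norm_nonneg _))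
  rw [ℓ.integral_comp_comm, ℓ.integral_comp_comm, ← map_sub] at key
  · exact key.trans_eq (by ring)
  · exact integrable_of_continuousOn_of_compl_null hK hμ₀ hq.continuous.continuousOn
  · exact integrable_of_continuousOn_of_compl_null hK h.compl_null hq.continuous.continuousOn

lemma exists_contDiff_norm_sub_le {W : Type*} [NormedAddCommGroup W] [NormedSpace ℝ W]
    [FiniteDimensional ℝ W] {p : W → F} (hp : Continuous p) {L : Set W} (hL : IsCompact L) {η : ℝ}
    (hη : 0 < η) : ∃ q : W → F, ContDiff ℝ 1 q ∧ ∀ z ∈ L, ‖p z - q z‖ ≤ η := by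
  obtain ⟨q, hq, hpq⟩ := (mem_closure_iff_nhds_basis (nhds_basis_uniformity
    Metric.uniformity_basis_dist.compactConvergenceUniformity)).1
      (ContinuousMap.dense_setOfPred_contDiff ⟨p, hp⟩) (L, η) ⟨hL, hη⟩
  refine ⟨q, (mem_ofPred.1 hq).of_le (by simp), fun z hz => ?_⟩
  rw [norm_sub_rev, ← dist_eq_norm]
  exact (hpq z hz).le

variable {W : Type*} [NormedAddCommGroup W] [NormedSpace ℝ W] [FiniteDimensional ℝ W]

lemma eventually_norm_integral_sub_le (hK : IsCompact K) [IsProbabilityMeasure ν₀]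
    (hν₀ : ν₀ Kᶜ = 0) {L : Set W} (hL : IsCompact L) {p : W → V → F}
    (hp : Continuous (Function.uncurry p)) {η : ℝ} (hη : 0 < η) :
    ∀ᶠ r in 𝓝[≥] (0 : ℝ), ∀ ν, DualClose K r ν ν₀ →
      ∀ x ∈ L, ‖∫ y, p x y ∂ν - ∫ y, p x y ∂ν₀‖ ≤ η := by
  obtain ⟨q, hq, hpq⟩ := exists_contDiff_norm_sub_le hp (hL.prod hK) (show 0 < η / 3 by positivity)
  obtain ⟨B, hB₀, hB⟩ := exists_bound_norm_fderiv hq (hL.prod hK)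
  filter_upwards [eventually_mul_le hB₀ (show 0 < η / 3 by positivity)] with r hr ν hν x hx
  have := hν.isProbabilityMeasure
  have hpx : Continuous (p x) := by fun_prop
  have hqx : ContDiff ℝ 1 fun y => q (x, y) := by fun_prop
  have hpq' (ρ : Measure V) [IsProbabilityMeasure ρ] (hρ : ρ Kᶜ = 0) :
      ‖∫ y, p x y ∂ρ - ∫ y, q (x, y) ∂ρ‖ ≤ η / 3 := by
    rw [← integral_sub (integrable_of_continuousOn_of_compl_null hK hρ hpx.continuousOn)
      (integrable_of_continuousOn_of_compl_null hK hρ hqx.continuous.continuousOn)]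
    exact norm_integral_le_of_compl_null hρ fun y hy => hpq (x, y) ⟨hx, hy⟩
  have hqν : ‖∫ y, q (x, y) ∂ν - ∫ y, q (x, y) ∂ν₀‖ ≤ r * B :=
    hν.norm_integral_sub_le hK hν₀ hqx (mul_nonneg hr.1 hB₀.le)
      (fun y hy => (hB _ ⟨hx, hy⟩).1) fun y hy =>
        (norm_fderiv_right_le (G := fun x y => q (x, y))
          (hq.differentiable one_ne_zero (x, y))).trans (hB _ ⟨hx, hy⟩).2
  have htri := norm_sub_le_norm_sub_add_norm_sub (∫ y, p x y ∂ν) (∫ y, q (x, y) ∂ν)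
    (∫ y, p x y ∂ν₀)
  have htri' := norm_sub_le_norm_sub_add_norm_sub (∫ y, q (x, y) ∂ν) (∫ y, q (x, y) ∂ν₀)
    (∫ y, p x y ∂ν₀)
  rw [norm_sub_rev (∫ y, q (x, y) ∂ν₀)] at htri'
  linarith [hpq' ν hν.compl_null, hpq' ν₀ hν₀, hr.2]

lemma eventually_abs_second_difference_le (hK : IsCompact K) [IsProbabilityMeasure ν₀]
    (hν₀ : ν₀ Kᶜ = 0) {G : V → V → ℝ} (hG : ContDiff ℝ 1 (Function.uncurry G)) {η : ℝ}
    (hη : 0 < η) :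
    ∀ᶠ r in 𝓝[≥] (0 : ℝ), ∀ μ ν, DualClose K r μ μ₀ → DualClose K r ν ν₀ →
      |∫ x, (∫ y, G x y ∂ν - ∫ y, G x y ∂ν₀) ∂μ - ∫ x, (∫ y, G x y ∂ν - ∫ y, G x y ∂ν₀) ∂μ₀|
        ≤ η * r := by
  have hG' : Continuous fun p : V × V => fderiv ℝ (fun x => G x p.2) p.1 :=
    continuous_fderiv_left hG
  have hGx (x : V) : Continuous (G x) := by have := hG.continuous; fun_prop
  have hGy (y : V) : Differentiable ℝ fun x => G x y := fun x =>
    (hasFDerivAt_uncurry_left (hG.differentiable one_ne_zero (x, y))).differentiableAt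
  filter_upwards [eventually_norm_integral_sub_le hK hν₀ hK hG.continuous hη,
    eventually_norm_integral_sub_le hK hν₀ hK (p := fun x y => fderiv ℝ (fun x => G x y) x) hG' hη]
    with r hr hr' μ ν hμ hν
  have := hν.isProbabilityMeasure
  have hderiv (ρ : Measure V) [IsProbabilityMeasure ρ] (hρ : ρ Kᶜ = 0) :=
    hasFDerivAt_integral_of_compl_null hK hρ hGx hGy hG'
  rw [mul_comm]
  refine hμ.abs_integral_sub_le _ η
    ((contDiff_integral_of_compl_null hK hν.compl_null hGx hGy hG').sub
      (contDiff_integral_of_compl_null hK hν₀ hGx hGy hG')) (hr ν hν) fun x hx => ?_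
  have h := ((hderiv ν hν.compl_null x).sub (hderiv ν₀ hν₀ x)).fderiv
  exact (congrArg norm h).trans_le (hr' ν hν x hx)

end DualClose

section SoftTransformSmooth

variable {V W : Type*} [NormedAddCommGroup V] [NormedSpace ℝ V] [FiniteDimensional ℝ V]
  [TopologicalSpace W] [CompactSpace W] [T2Space W] [SecondCountableTopology W]
  [MeasurableSpace W] [OpensMeasurableSpace W]

lemma contDiff_softTransform {c : V → W → ℝ} (ν : Measure W) [IsProbabilityMeasure ν]
    (hc : Continuous (Function.uncurry c)) (hd : ∀ y, Differentiable ℝ fun x => c x y)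
    (hc' : Continuous fun p : V × W => fderiv ℝ (fun x => c x p.2) p.1) (g : C(W, ℝ)) :
    ContDiff ℝ 1 (softTransform c ν g) := by
  have hexp (p : V × W) := ((hd p.2 p.1).hasFDerivAt.const_sub (g p.2)).exp
  have hint (x : V) : Continuous fun y => Real.exp (g y - c x y) := by fun_prop
  refine (ContDiff.log (contDiff_integral_of_compl_null isCompact_univ (by simp) hint
    (fun y x => (hexp (x, y)).differentiableAt) ?_) fun x => ?_).neg
  · simp_rw [(hexp _).fderiv]
    have hc₂ : Continuous fun p : V × W => c p.1 p.2 := hc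
    fun_prop
  · exact (integral_exp_pos ((hint x).integrable_of_hasCompactSupport (.of_compactSpace _))).ne'

end SoftTransformSmooth

section ExistencePotentials

lemma isProbabilityMeasure_comap_val {α : Type*} [MeasurableSpace α] {μ : Measure α}
    [IsProbabilityMeasure μ] {K : Set α} (hK : MeasurableSet K) (hμ : μ Kᶜ = 0) :
    IsProbabilityMeasure (μ.comap (Subtype.val : K → α)) := by
  constructor
  rw [(MeasurableEmbedding.subtype_coe hK).comap_apply, image_univ, Subtype.range_coe,
    (prob_compl_eq_zero_iff hK).1 hμ]

variable {V : Type*} [NormedAddCommGroup V] [MeasurableSpace V] [BorelSpace V] {K : Set V}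
  {μ ν : Measure V} [IsProbabilityMeasure μ] [IsProbabilityMeasure ν]

lemma integral_exp_softTransform_comap_val {c : V → V → ℝ} (hc : Continuous (Function.uncurry c))
    (hK : IsCompact K) (hν : ν Kᶜ = 0) {g : V → ℝ} {g₀ : C(K, ℝ)} (hg : ∀ y : K, g y = g₀ y)
    (x : V) :
    ∫ y, Real.exp (softTransform (fun x (y : K) => c x y) (ν.comap Subtype.val) g₀ x
      + g y - c x y) ∂ν = 1 := by
  have : CompactSpace K := isCompact_iff_compactSpace.1 hK
  have := isProbabilityMeasure_comap_val hK.measurableSet hν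
  set ρ : Measure K := ν.comap Subtype.val
  rw [← Measure.restrict_eq_self_of_ae_mem (mem_ae_iff.2 hν),
    ← integral_subtype_comap hK.measurableSet]
  simp_rw [hg]
  have hexp : Continuous fun y : K => Real.exp (g₀ y - c x y) := by fun_prop
  have hint : Integrable (fun y : K => Real.exp (g₀ y - c x y)) ρ :=
    hexp.integrable_of_hasCompactSupport (.of_compactSpace _)
  exact integral_exp_softTransform (c := fun x (y : K) => c x y) hint

variable [NormedSpace ℝ V] [FiniteDimensional ℝ V]

lemma exists_contDiff_integral_exp_eq_one {c : V → V → ℝ}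
    (hc : ContDiff ℝ 1 (Function.uncurry c)) (hK : IsCompact K) (hμ : μ Kᶜ = 0) (hν : ν Kᶜ = 0) :
    ∃ f g : V → ℝ, ContDiff ℝ 1 f ∧ ContDiff ℝ 1 g ∧
      (∀ x, ∫ y, Real.exp (f x + g y - c x y) ∂ν = 1) ∧
      ∀ y, ∫ x, Real.exp (f x + g y - c x y) ∂μ = 1 := by
  have : CompactSpace K := isCompact_iff_compactSpace.1 hK
  have := isProbabilityMeasure_comap_val hK.measurableSet hμ
  have := isProbabilityMeasure_comap_val hK.measurableSet hν
  have hsmooth {c : V → V → ℝ} (hc : ContDiff ℝ 1 (Function.uncurry c)) (ρ : Measure K)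
      [IsProbabilityMeasure ρ] (u : C(K, ℝ)) :
      ContDiff ℝ 1 (softTransform (fun x (y : K) => c x y) ρ u) :=
    contDiff_softTransform (c := fun x (y : K) => c x y) ρ
      (hc.continuous.comp (f := fun p : V × K => (p.1, (p.2 : V))) (by fun_prop))
      (fun y x => (hasFDerivAt_uncurry_left
        (hc.differentiable one_ne_zero (x, (y : V)))).differentiableAt)
      ((continuous_fderiv_left hc).comp (f := fun p : V × K => (p.1, (p.2 : V))) (by fun_prop)) u
  have hswap : ContDiff ℝ 1 (Function.uncurry (Function.swap c)) :=
    hc.comp (contDiff_snd.prodMk contDiff_fst)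
  obtain ⟨f, g, hf, hg⟩ := exists_eq_softTransform (ν.comap Subtype.val) (μ.comap Subtype.val)
    (c := fun x y : K => c x y)
    (hc.continuous.comp (f := fun p : K × K => ((p.1 : V), (p.2 : V))) (by fun_prop))
  refine ⟨_, _, hsmooth hc (ν.comap Subtype.val) g, hsmooth hswap (μ.comap Subtype.val) f,
    integral_exp_softTransform_comap_val hc.continuous hK hν fun y => (hg y).symm, fun y => ?_⟩
  simpa only [add_comm, Function.swap] using integral_exp_softTransform_comap_val
    hswap.continuous hK hμ (fun x => (hf x).symm) y

end ExistencePotentials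

section Potentials

variable {d : ℕ} {c : E d → E d → ℝ} {ε : ℝ} {μ ν : Measure (E d)} {K : Set (E d)} {f g : E d → ℝ}

/-- The functions `f` and `g` are smooth Schrödinger potentials of `μ` and `ν`: their Gibbs kernel
is the density of a coupling, and the Schrödinger equations hold at all points, not only almost
everywhere. -/
structure IsPotential (c : E d → E d → ℝ) (ε : ℝ) (μ ν : Measure (E d)) (f g : E d → ℝ) :
    Prop where
  contDiff_left : ContDiff ℝ 1 f
  contDiff_right : ContDiff ℝ 1 g
  integral_snd : ∀ x, ∫ y, gibbsKernel c ε f g (x, y) ∂ν = 1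
  integral_fst : ∀ y, ∫ x, gibbsKernel c ε f g (x, y) ∂μ = 1

theorem exists_isPotential [IsProbabilityMeasure μ] [IsProbabilityMeasure ν]
    (hc : ContDiff ℝ 1 (Function.uncurry c)) (hε : 0 < ε) (hK : IsCompact K) (hμ : μ Kᶜ = 0)
    (hν : ν Kᶜ = 0) : ∃ f g, IsPotential c ε μ ν f g := by
  have hcε : ContDiff ℝ 1 (Function.uncurry fun x y => c x y / ε) := hc.div_const ε
  obtain ⟨f, g, hf, hg, h₁, h₂⟩ := exists_contDiff_integral_exp_eq_one hcε hK hμ hν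
  have hG (x y : E d) : gibbsKernel c ε (fun x => ε * f x) (fun y => ε * g y) (x, y)
      = Real.exp (f x + g y - c x y / ε) := by
    simp only [gibbsKernel]
    congr 1
    field_simp
  exact ⟨fun x => ε * f x, fun y => ε * g y, contDiff_const.mul hf, contDiff_const.mul hg,
    by simpa only [hG] using h₁, by simpa only [hG] using h₂⟩

namespace IsPotential

lemma swap (h : IsPotential c ε μ ν f g) : IsPotential (Function.swap c) ε ν μ g f where
  contDiff_left := h.contDiff_right
  contDiff_right := h.contDiff_left
  integral_snd x := by simpa only [gibbsKernel, Function.swap, add_comm] using h.integral_fst x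
  integral_fst y := by simpa only [gibbsKernel, Function.swap, add_comm] using h.integral_snd y

lemma contDiff_gibbsKernel (h : IsPotential c ε μ ν f g) (hc : ContDiff ℝ 1 (Function.uncurry c)) :
    ContDiff ℝ 1 (gibbsKernel c ε f g) := by
  have hc' : ContDiff ℝ 1 fun p : E d × E d => c p.1 p.2 := hc
  exact ((((h.contDiff_left.comp contDiff_fst).add (h.contDiff_right.comp contDiff_snd)).sub
    hc').div_const ε).exp

lemma apply_le_add (h : IsPotential c ε μ ν f g) (hε : 0 < ε) (hν : ν Kᶜ = 0) {x x' : E d}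
    {a : ℝ} (hxx' : ∀ y ∈ K, c x y ≤ c x' y + a) : f x ≤ f x' + a := by
  have hint (z : E d) : Integrable (fun y => gibbsKernel c ε f g (z, y)) ν :=
    .of_integral_ne_zero (by simp [h.integral_snd z])
  have hmono : ∫ y, Real.exp ((f x - f x' - a) / ε) * gibbsKernel c ε f g (x', y) ∂ν
      ≤ ∫ y, gibbsKernel c ε f g (x, y) ∂ν := by
    refine integral_mono_ae ((hint x').const_mul _) (hint x) ?_
    filter_upwards [mem_ae_iff.2 hν] with y hy
    simp only [gibbsKernel]
    rw [← Real.exp_add, ← add_div]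
    gcongr
    linarith [hxx' y hy]
  rw [integral_const_mul, h.integral_snd, h.integral_snd, mul_one, Real.exp_le_one_iff,
    div_le_iff₀ hε] at hmono
  linarith

lemma norm_fderiv_le (h : IsPotential c ε μ ν f g) (hε : 0 < ε) (hν : ν Kᶜ = 0) {x : E d} {L : ℝ}
    (hL : 0 ≤ L) (hcL : ∀ᶠ z in 𝓝 x, ∀ y ∈ K, |c z y - c x y| ≤ L * ‖z - x‖) :
    ‖fderiv ℝ f x‖ ≤ L := by
  refine (h.contDiff_left.differentiable one_ne_zero x).hasFDerivAt.le_of_lip' hL ?_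
  filter_upwards [hcL] with z hz
  have h₁ : f z ≤ f x + L * ‖z - x‖ :=
    h.apply_le_add hε hν fun y hy => by linarith [(abs_le.1 (hz y hy)).2]
  have h₂ : f x ≤ f z + L * ‖z - x‖ :=
    h.apply_le_add hε hν fun y hy => by linarith [(abs_le.1 (hz y hy)).1]
  exact abs_le.2 ⟨by linarith, by linarith⟩

end IsPotential

lemma exists_eventually_abs_sub_le (hc : ContDiff ℝ 1 (Function.uncurry c)) (hK : IsCompact K) :
    ∃ L, 0 ≤ L ∧ ∀ x ∈ K, ∀ᶠ z in 𝓝 x, ∀ y ∈ K, |c z y - c x y| ≤ L * ‖z - x‖ := by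
  obtain ⟨L, hL⟩ := hc.locallyLipschitz.locallyLipschitzOn.exists_lipschitzOnWith_of_compact
    ((hK.cthickening (r := 1)).prod hK)
  refine ⟨L, L.2, fun x hx => ?_⟩
  filter_upwards [Metric.closedBall_mem_nhds x one_pos] with z hz y hy
  have h := hL.dist_le_mul (z, y) ⟨Metric.mem_cthickening_of_dist_le z x 1 K hx hz, hy⟩ (x, y)
    ⟨Metric.self_subset_cthickening K hx, hy⟩
  simpa [Prod.dist_eq, Real.dist_eq, dist_eq_norm] using h

end Potentials

section Expansion

variable {d : ℕ} {c : E d → E d → ℝ} {ε : ℝ} {μ₀ ν₀ : Measure (E d)} {K : Set (E d)}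
  {f g : E d → ℝ}

namespace IsPotential

lemma exists_abs_integral_gibbsKernel_sub_one_le (h : IsPotential c ε μ₀ ν₀ f g)
    (hc : ContDiff ℝ 1 (Function.uncurry c)) (hK : IsCompact K) :
    ∃ M, 0 < M ∧ ∀ r μ ν, DualClose K r μ μ₀ → DualClose K r ν ν₀ →
      (∀ x ∈ K, |∫ y, gibbsKernel c ε f g (x, y) ∂ν - 1| ≤ r * M) ∧
      ∀ y ∈ K, |∫ x, gibbsKernel c ε f g (x, y) ∂μ - 1| ≤ r * M := by
  have hG := h.contDiff_gibbsKernel hc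
  have hdiff (x y : E d) : DifferentiableAt ℝ
      (Function.uncurry fun x y => gibbsKernel c ε f g (x, y)) (x, y) :=
    hG.differentiable one_ne_zero (x, y)
  obtain ⟨M, hM₀, hM⟩ := exists_bound_norm_fderiv hG (hK.prod hK)
  refine ⟨M, hM₀, fun r μ ν hμ hν => ⟨fun x hx => ?_, fun y hy => ?_⟩⟩
  · rw [← h.integral_snd x]
    exact hν.abs_integral_sub_le _ M (by fun_prop) (fun y hy => (hM (x, y) ⟨hx, hy⟩).1)
      fun y hy => (norm_fderiv_right_le (hdiff x y)).trans (hM (x, y) ⟨hx, hy⟩).2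
  · rw [← h.integral_fst y]
    exact hμ.abs_integral_sub_le _ M (by fun_prop) (fun x hx => (hM (x, y) ⟨hx, hy⟩).1)
      fun x hx => (norm_fderiv_left_le (hdiff x y)).trans (hM (x, y) ⟨hx, hy⟩).2

lemma eventually_abs_entropicCost_sub_dualValue_le (h : IsPotential c ε μ₀ ν₀ f g)
    (hc : ContDiff ℝ 1 (Function.uncurry c)) (hε : 0 < ε) (hK : IsCompact K) {η : ℝ}
    (hη : 0 < η) :
    ∀ᶠ r in 𝓝[≥] (0 : ℝ), ∀ μ ν, DualClose K r μ μ₀ → DualClose K r ν ν₀ →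
      |entropicCost c ε μ ν - dualValue c ε μ ν f g| ≤ η * r := by
  have hf := h.contDiff_left.continuous
  have hg := h.contDiff_right.continuous
  obtain ⟨M, hM₀, hM⟩ := h.exists_abs_integral_gibbsKernel_sub_one_le hc hK
  obtain ⟨b, hb₀, hb⟩ := (hK.prod hK).exists_forall_le' (a := 0)
    (continuous_gibbsKernel (ε := ε) hc.continuous hf hg).continuousOn fun p _ => gibbsKernel_pos p
  filter_upwards [eventually_mul_le (show 0 < 3 * M by positivity) hb₀,
    eventually_mul_le (show 0 < 9 * ε * M ^ 2 / b by positivity) hη] with r hr hr' μ ν hμ hν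
  have := hμ.isProbabilityMeasure
  have := hν.isProbabilityMeasure
  obtain ⟨hM₁, hM₂⟩ := hM r μ ν hμ hν
  have hlower := dualValue_le_entropicCost hc.continuous hε hK hμ.compl_null hν.compl_null hf hg
  have hupper := entropicCost_le_dualValue_add hc.continuous hε hK hμ.compl_null hν.compl_null
    hf hg hb (by linarith [hr.2]) hb₀ hM₁ hM₂
  rw [abs_of_nonneg (sub_nonneg.2 hlower), sub_le_iff_le_add']
  refine hupper.trans (add_le_add_right ?_ _)
  calc ε * ((3 * (r * M)) ^ 2 / b) = r * (9 * ε * M ^ 2 / b) * r := by ring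
    _ ≤ η * r := mul_le_mul_of_nonneg_right hr'.2 hr'.1

variable [IsProbabilityMeasure μ₀]

lemma integral_gibbsKernel_sub_one (h : IsPotential c ε μ₀ ν₀ f g)
    (hc : ContDiff ℝ 1 (Function.uncurry c)) (hK : IsCompact K) (hμ₀ : μ₀ Kᶜ = 0)
    {μ ν : Measure (E d)} [IsProbabilityMeasure μ] [IsProbabilityMeasure ν] (hμ : μ Kᶜ = 0)
    (hν : ν Kᶜ = 0) :
    ∫ p, (gibbsKernel c ε f g p - 1) ∂(μ.prod ν) =
      ∫ x, (∫ y, gibbsKernel c ε f g (x, y) ∂ν - ∫ y, gibbsKernel c ε f g (x, y) ∂ν₀) ∂μ -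
        ∫ x, (∫ y, gibbsKernel c ε f g (x, y) ∂ν - ∫ y, gibbsKernel c ε f g (x, y) ∂ν₀) ∂μ₀ := by
  have hG := (h.contDiff_gibbsKernel hc).continuous
  have hint {ρ : Measure (E d)} [IsProbabilityMeasure ρ] (hρ : ρ Kᶜ = 0) :
      Integrable (gibbsKernel c ε f g) (ρ.prod ν) :=
    integrable_prod_of_continuous hK hK hρ hν hG
  have hmass : ∫ x, ∫ y, gibbsKernel c ε f g (x, y) ∂ν ∂μ₀ = 1 := by
    rw [integral_integral_swap (f := fun x y => gibbsKernel c ε f g (x, y)) (hint hμ₀)]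
    simp [h.integral_fst]
  simp_rw [h.integral_snd]
  rw [integral_sub (hint hμ).integral_prod_left (integrable_const _),
    integral_sub (hint hμ₀).integral_prod_left (integrable_const _), hmass,
    integral_sub (hint hμ) (integrable_const _), integral_prod _ (hint hμ)]
  simp

variable [IsProbabilityMeasure ν₀]

lemma eventually_abs_dualValue_sub_le (h : IsPotential c ε μ₀ ν₀ f g)
    (hc : ContDiff ℝ 1 (Function.uncurry c)) (hε : 0 < ε) (hK : IsCompact K) (hμ₀ : μ₀ Kᶜ = 0)
    (hν₀ : ν₀ Kᶜ = 0) {η : ℝ} (hη : 0 < η) :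
    ∀ᶠ r in 𝓝[≥] (0 : ℝ), ∀ μ ν, DualClose K r μ μ₀ → DualClose K r ν ν₀ →
      |dualValue c ε μ ν f g - (∫ x, f x ∂μ + ∫ y, g y ∂ν)| ≤ η * r := by
  filter_upwards [eventually_abs_second_difference_le (μ₀ := μ₀) hK hν₀
    (G := fun x y => gibbsKernel c ε f g (x, y)) (h.contDiff_gibbsKernel hc) (div_pos hη hε)]
    with r hr μ ν hμ hν
  have := hμ.isProbabilityMeasure
  have := hν.isProbabilityMeasure
  have hsecond := hr μ ν hμ hν
  rw [← h.integral_gibbsKernel_sub_one hc hK hμ₀ hμ.compl_null hν.compl_null] at hsecond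
  rw [dualValue, sub_sub_cancel_left, abs_neg, abs_mul, abs_of_pos hε]
  calc ε * |∫ p, (gibbsKernel c ε f g p - 1) ∂(μ.prod ν)| ≤ ε * (η / ε * r) := by gcongr
    _ = η * r := by field_simp

theorem eventually_abs_entropicCost_sub_le (h : IsPotential c ε μ₀ ν₀ f g)
    (hc : ContDiff ℝ 1 (Function.uncurry c)) (hε : 0 < ε) (hK : IsCompact K) (hμ₀ : μ₀ Kᶜ = 0)
    (hν₀ : ν₀ Kᶜ = 0) {η : ℝ} (hη : 0 < η) :
    ∀ᶠ r in 𝓝[≥] (0 : ℝ), ∀ μ ν, DualClose K r μ μ₀ → DualClose K r ν ν₀ →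
      |entropicCost c ε μ ν - (∫ x, f x ∂μ + ∫ y, g y ∂ν)| ≤ η * r := by
  filter_upwards [h.eventually_abs_entropicCost_sub_dualValue_le hc hε hK (half_pos hη),
    h.eventually_abs_dualValue_sub_le hc hε hK hμ₀ hν₀ (half_pos hη)] with r hr hr' μ ν hμ hν
  linarith [abs_sub_le (entropicCost c ε μ ν) (dualValue c ε μ ν f g)
    (∫ x, f x ∂μ + ∫ y, g y ∂ν), hr μ ν hμ hν, hr' μ ν hμ hν]

end IsPotential

end Expansion

section DualDeriv

variable {V : Type*} [NormedAddCommGroup V] [NormedSpace ℝ V] [MeasurableSpace V]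
  {F : Measure V → ℝ} {φ : V → ℝ} {K : Set V} {m : ℝ → Measure V} {J : Set ℝ} {t : ℝ}

/-- The `C¹` function `φ` is the derivative of `F` at `μ` for the dual of the `C¹` norm on each
compact set on which `μ` is concentrated. -/
structure HasDualDeriv (F : Measure V → ℝ) (μ : Measure V) (φ : V → ℝ) : Prop where
  contDiff : ContDiff ℝ 1 φ
  eventually_abs_sub_le : ∀ K, IsCompact K → μ Kᶜ = 0 → ∀ η > 0, ∀ᶠ r in 𝓝[≥] (0 : ℝ),
    ∀ ν, DualClose K r ν μ → |F ν - F μ - (∫ x, φ x ∂ν - ∫ x, φ x ∂μ)| ≤ η * r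

/-- The functional `F` has a dual derivative at all compactly supported probability measures, with
a bound on its gradient that only depends on a compact set carrying the measure. -/
def HasBoundedDualDeriv (F : Measure V → ℝ) : Prop :=
  ∀ K, IsCompact K → ∃ L, 0 ≤ L ∧ ∀ μ, IsProbabilityMeasure μ → μ Kᶜ = 0 →
    ∃ φ, HasDualDeriv F μ φ ∧ ∀ x ∈ K, ‖fderiv ℝ φ x‖ ≤ L

/-- The curve `m` consists of probability measures on `K` near `t` within `J`, and is Lipschitz at
`t` for the dual of the `C¹` norm on `K`. -/
def DualLipschitzWithinAt (K : Set V) (m : ℝ → Measure V) (J : Set ℝ) (t : ℝ) : Prop :=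
  ∃ C, 0 ≤ C ∧ ∀ᶠ s in 𝓝[J] t, DualClose K (C * |s - t|) (m s) (m t)

lemma DualLipschitzWithinAt.dualClose_self (hm : DualLipschitzWithinAt K m J t) (ht : t ∈ J) :
    DualClose K 0 (m t) (m t) := by
  obtain ⟨C, -, hC⟩ := hm
  simpa using hC.self_of_nhdsWithin ht

theorem HasDualDeriv.comp_hasDerivWithinAt (hF : HasDualDeriv F (m t) φ) (hK : IsCompact K)
    (ht : t ∈ J) (hm : DualLipschitzWithinAt K m J t) {a : ℝ}
    (ha : HasDerivWithinAt (fun s => ∫ x, φ x ∂(m s)) a J t) :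
    HasDerivWithinAt (fun s => F (m s)) a J t := by
  have hnull := (hm.dualClose_self ht).compl_null
  obtain ⟨C, hC, hm⟩ := hm
  suffices hzero : HasDerivWithinAt (fun s => F (m s) - ∫ x, φ x ∂(m s)) 0 J t by
    simpa using hzero.fun_add ha
  have hdist : Tendsto (fun s => C * |s - t|) (𝓝[J] t) (𝓝[≥] 0) := by
    refine tendsto_nhdsWithin_iff.2 ⟨Tendsto.mono_left ?_ nhdsWithin_le_nhds,
      .of_forall fun s => mul_nonneg hC (abs_nonneg _)⟩
    exact Continuous.tendsto' (by fun_prop) _ _ (by simp)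
  rw [hasDerivWithinAt_iff_isLittleO, Asymptotics.isLittleO_iff]
  intro κ hκ
  filter_upwards [hm, hdist.eventually
    (hF.eventually_abs_sub_le K hK hnull (κ / (C + 1)) (by positivity))] with s hs hexp
  calc ‖F (m s) - ∫ x, φ x ∂(m s) - (F (m t) - ∫ x, φ x ∂(m t)) - (s - t) • (0 : ℝ)‖
      = |F (m s) - F (m t) - (∫ x, φ x ∂(m s) - ∫ x, φ x ∂(m t))| := by
        rw [smul_zero, sub_zero, sub_sub_sub_comm, Real.norm_eq_abs]
    _ ≤ κ / (C + 1) * (C * |s - t|) := hexp _ hs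
    _ ≤ κ / (C + 1) * ((C + 1) * |s - t|) := by gcongr; linarith
    _ = κ * ‖s - t‖ := by rw [Real.norm_eq_abs]; field_simp

end DualDeriv

section SinkhornDivergence

variable {d : ℕ} {c : E d → E d → ℝ} {ε : ℝ} {μ μs : Measure (E d)} {K : Set (E d)}
  {f g f' g' : E d → ℝ}

lemma eventually_abs_sinkhornDiv_sub_le [IsProbabilityMeasure μ] [IsProbabilityMeasure μs]
    (h : IsPotential c ε μ μs f g) (h' : IsPotential c ε μ μ f' g')
    (hc : ContDiff ℝ 1 (Function.uncurry c)) (hε : 0 < ε) (hK : IsCompact K) (hμ : μ Kᶜ = 0)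
    (hμs : μs Kᶜ = 0) {η : ℝ} (hη : 0 < η) :
    ∀ᶠ r in 𝓝[≥] (0 : ℝ), ∀ ν, DualClose K r ν μ →
      |sinkhornDiv c ε μs ν - ∫ x, (f x - (f' x + g' x) / 2) ∂ν
        - (∫ y, g y ∂μs - entropicCost c ε μs μs / 2)| ≤ η * r := by
  filter_upwards [h.eventually_abs_entropicCost_sub_le hc hε hK hμ hμs (half_pos hη),
    h'.eventually_abs_entropicCost_sub_le hc hε hK hμ hμ hη, self_mem_nhdsWithin]
    with r hr hr' hr₀ ν hν
  have := hν.isProbabilityMeasure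
  have hint {u : E d → ℝ} (hu : ContDiff ℝ 1 u) : Integrable u ν :=
    integrable_of_continuousOn_of_compl_null hK hν.compl_null hu.continuous.continuousOn
  have hf' := h'.contDiff_left
  have hg' := h'.contDiff_right
  rw [integral_sub (hint h.contDiff_left) (hint (by fun_prop)), integral_div,
    integral_add (hint hf') (hint hg'), sinkhornDiv]
  have hcross := abs_le.1 (hr ν μs hν (.self hμs hr₀))
  have hself := abs_le.1 (hr' ν ν hν hν)
  exact abs_le.2 ⟨by linarith [hcross.1, hself.2], by linarith [hcross.2, hself.1]⟩

theorem hasDualDeriv_sinkhornDiv [IsProbabilityMeasure μ] [IsProbabilityMeasure μs]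
    (h : IsPotential c ε μ μs f g) (h' : IsPotential c ε μ μ f' g')
    (hc : ContDiff ℝ 1 (Function.uncurry c)) (hε : 0 < ε) (hK : IsCompact K) (hμs : μs Kᶜ = 0) :
    HasDualDeriv (sinkhornDiv c ε μs) μ fun x => f x - (f' x + g' x) / 2 := by
  refine ⟨h.contDiff_left.sub ((h'.contDiff_left.add h'.contDiff_right).div_const 2),
    fun L hL hμ η hη => ?_⟩
  have hμLK : μ (L ∪ K)ᶜ = 0 := measure_mono_null (compl_subset_compl.2 subset_union_left) hμ
  have hμsLK : μs (L ∪ K)ᶜ = 0 := measure_mono_null (compl_subset_compl.2 subset_union_right) hμs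
  filter_upwards [eventually_abs_sinkhornDiv_sub_le h h' hc hε (hL.union hK) hμLK hμsLK
    (half_pos hη), self_mem_nhdsWithin] with r hr hr₀ ν hν
  have hexp := abs_le.1 (hr ν (hν.mono_set subset_union_left))
  have hexp₀ := abs_le.1 (hr μ (.self hμLK hr₀))
  exact abs_le.2 ⟨by linarith [hexp.1, hexp₀.2], by linarith [hexp.2, hexp₀.1]⟩

lemma exists_norm_fderiv_potential_le (hc : ContDiff ℝ 1 (Function.uncurry c)) (hε : 0 < ε)
    (hK : IsCompact K) :
    ∃ L, 0 ≤ L ∧ ∀ μ ν f g, μ Kᶜ = 0 → ν Kᶜ = 0 → IsPotential c ε μ ν f g →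
      ∀ x ∈ K, ‖fderiv ℝ f x‖ ≤ L ∧ ‖fderiv ℝ g x‖ ≤ L := by
  obtain ⟨L₁, hL₁, hcL₁⟩ := exists_eventually_abs_sub_le hc hK
  obtain ⟨L₂, hL₂, hcL₂⟩ := exists_eventually_abs_sub_le (c := Function.swap c)
    (hc.comp (contDiff_snd.prodMk contDiff_fst)) hK
  exact ⟨max L₁ L₂, hL₁.trans (le_max_left _ _), fun μ ν f g hμ hν h x hx =>
    ⟨(h.norm_fderiv_le hε hν hL₁ (hcL₁ x hx)).trans (le_max_left _ _),
      (h.swap.norm_fderiv_le hε hμ hL₂ (hcL₂ x hx)).trans (le_max_right _ _)⟩⟩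

theorem hasBoundedDualDeriv_sinkhornDiv [IsProbabilityMeasure μs]
    (hc : ContDiff ℝ 1 (Function.uncurry c)) (hε : 0 < ε) (hK : IsCompact K) (hμs : μs Kᶜ = 0) :
    HasBoundedDualDeriv (sinkhornDiv c ε μs) := by
  intro L hL
  have hLK := hL.union hK
  obtain ⟨B, hB₀, hB⟩ := exists_norm_fderiv_potential_le hc hε hLK
  refine ⟨2 * B, by positivity, fun μ _ hμ => ?_⟩
  have hμLK : μ (L ∪ K)ᶜ = 0 := measure_mono_null (compl_subset_compl.2 subset_union_left) hμ
  have hμsLK : μs (L ∪ K)ᶜ = 0 := measure_mono_null (compl_subset_compl.2 subset_union_right) hμs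
  obtain ⟨f, g, h⟩ := exists_isPotential hc hε hLK hμLK hμsLK
  obtain ⟨f', g', h'⟩ := exists_isPotential hc hε hLK hμLK hμLK
  refine ⟨_, hasDualDeriv_sinkhornDiv h h' hc hε hK hμs, fun x hx => ?_⟩
  have hf := (h.contDiff_left.differentiable one_ne_zero x).hasFDerivAt
  have hf' := (h'.contDiff_left.differentiable one_ne_zero x).hasFDerivAt
  have hg' := (h'.contDiff_right.differentiable one_ne_zero x).hasFDerivAt
  have hφ := hf.fun_sub ((hf'.fun_add hg').mul_const (2 : ℝ)⁻¹)
  have hbound := hB μ μs f g hμLK hμsLK h x (.inl hx)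
  have hbound' := hB μ μ f' g' hμLK hμLK h' x (.inl hx)
  simp_rw [div_eq_mul_inv]
  rw [hφ.fderiv]
  calc ‖fderiv ℝ f x - (2 : ℝ)⁻¹ • (fderiv ℝ f' x + fderiv ℝ g' x)‖
      ≤ ‖fderiv ℝ f x‖ + 2⁻¹ * (‖fderiv ℝ f' x‖ + ‖fderiv ℝ g' x‖) := by
        refine (norm_sub_le _ _).trans (add_le_add_right ?_ _)
        rw [norm_smul, norm_inv, Real.norm_two]
        gcongr
        exact norm_add_le _ _
    _ ≤ 2 * B := by linarith [hbound.1, hbound'.1, hbound'.2]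

end SinkhornDivergence

section FirstVariation

variable {d : ℕ} {X K : Set (E d)} {F : Measure (E d) → ℝ} {μ ν : Measure (E d)} {φ ψ : E d → ℝ}

lemma continuous_gradient_of_contDiff (hφ : ContDiff ℝ 1 φ) : Continuous (gradient φ) :=
  (InnerProductSpace.toDual ℝ (E d)).symm.continuous.comp (hφ.continuous_fderiv one_ne_zero)

lemma perturb_zero (μ ν : Measure (E d)) : perturb μ ν 0 = μ := by simp [perturb]

lemma integral_perturb {r : ℝ} (hμ : Integrable φ μ) (hν : Integrable φ ν)
    (hr : r ∈ Icc (0 : ℝ) 1) :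
    ∫ x, φ x ∂(perturb μ ν r) = ∫ x, φ x ∂μ + r * (∫ x, φ x ∂ν - ∫ x, φ x ∂μ) := by
  rw [perturb, integral_add_measure (hμ.smul_measure ENNReal.ofReal_ne_top)
    (hν.smul_measure ENNReal.ofReal_ne_top), integral_smul_measure, integral_smul_measure,
    ENNReal.toReal_ofReal (by linarith [hr.2]), ENNReal.toReal_ofReal hr.1]
  simp only [smul_eq_mul]
  ring

lemma isProbabilityMeasure_perturb [IsProbabilityMeasure μ] [IsProbabilityMeasure ν] {r : ℝ}
    (hr : r ∈ Icc (0 : ℝ) 1) : IsProbabilityMeasure (perturb μ ν r) := by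
  constructor
  simp only [perturb, Measure.add_apply, Measure.smul_apply, measure_univ, smul_eq_mul, mul_one]
  rw [← ENNReal.ofReal_add (by linarith [hr.2]) hr.1, sub_add_cancel, ENNReal.ofReal_one]

lemma dualLipschitzWithinAt_perturb [IsProbabilityMeasure μ] [IsProbabilityMeasure ν]
    (hK : IsCompact K) (hμ : μ Kᶜ = 0) (hν : ν Kᶜ = 0) :
    DualLipschitzWithinAt K (perturb μ ν) (Ici 0) 0 := by
  refine ⟨2, zero_le_two, ?_⟩
  filter_upwards [Icc_mem_nhdsGE one_pos] with r hr
  refine ⟨isProbabilityMeasure_perturb hr, by simp [perturb, hμ, hν], fun h B hh hB _ => ?_⟩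
  have hμB : ‖∫ x, h x ∂μ‖ ≤ B := norm_integral_le_of_compl_null hμ hB
  have hνB : ‖∫ x, h x ∂ν‖ ≤ B := norm_integral_le_of_compl_null hν hB
  rw [perturb_zero,
    integral_perturb (integrable_of_continuousOn_of_compl_null hK hμ hh.continuous.continuousOn)
      (integrable_of_continuousOn_of_compl_null hK hν hh.continuous.continuousOn) hr,
    add_sub_cancel_left, sub_zero, abs_mul, mul_comm 2, mul_assoc]
  gcongr
  exact (norm_sub_le (∫ x, h x ∂ν) (∫ x, h x ∂μ)).trans (by linarith)

theorem HasDualDeriv.isFirstVariation (hF : HasDualDeriv F μ φ) (hμ : MemP X μ) :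
    IsFirstVariation X F μ φ := by
  have hint (ν : Measure (E d)) (hν : MemP X ν) : Integrable φ ν := by
    obtain ⟨_, L, -, hL, hνL⟩ := hν
    exact integrable_of_continuousOn_of_compl_null hL hνL hF.contDiff.continuous.continuousOn
  refine ⟨hint, fun ν hν => ?_⟩
  have hφμ := hint μ hμ
  have hφν := hint ν hν
  obtain ⟨_, K, -, hK, hμK⟩ := hμ
  obtain ⟨_, L, -, hL, hνL⟩ := hν
  refine HasDualDeriv.comp_hasDerivWithinAt (by rwa [perturb_zero]) (hK.union hL) self_mem_Ici
    (dualLipschitzWithinAt_perturb (hK.union hL)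
      (measure_mono_null (compl_subset_compl.2 subset_union_left) hμK)
      (measure_mono_null (compl_subset_compl.2 subset_union_right) hνL)) ?_
  have haffine : HasDerivWithinAt
      (fun r : ℝ => ∫ x, φ x ∂μ + r * (∫ x, φ x ∂ν - ∫ x, φ x ∂μ))
      (∫ x, φ x ∂ν - ∫ x, φ x ∂μ) (Ici 0) 0 := by
    simpa using ((hasDerivWithinAt_id (0 : ℝ) (Ici 0)).mul_const
      (∫ x, φ x ∂ν - ∫ x, φ x ∂μ)).const_add (∫ x, φ x ∂μ)
  refine haffine.congr_of_eventuallyEq_of_mem ?_ self_mem_Ici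
  filter_upwards [Icc_mem_nhdsGE one_pos] with r hr using integral_perturb hφμ hφν hr

lemma IsFirstVariation.exists_eqOn_add_const (hφ : IsFirstVariation X F μ φ)
    (hψ : IsFirstVariation X F μ ψ) : ∃ k, EqOn ψ (fun x => φ x + k) X := by
  refine ⟨∫ x, ψ x ∂μ - ∫ x, φ x ∂μ, fun x hx => ?_⟩
  have hdirac : MemP X (Measure.dirac x) :=
    ⟨inferInstance, {x}, singleton_subset_iff.2 hx, isCompact_singleton, by simp⟩
  have heq := (uniqueDiffOn_Ici (0 : ℝ) 0 self_mem_Ici).eq_deriv _ (hφ.2 _ hdirac)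
    (hψ.2 _ hdirac)
  rw [integral_dirac, integral_dirac] at heq
  linarith

lemma IsFirstVariation.isFirstVariation_firstVariation (hφ : IsFirstVariation X F μ φ) :
    IsFirstVariation X F μ (firstVariation X F μ) := by
  rw [firstVariation, dif_pos ⟨φ, hφ⟩]
  exact Exists.choose_spec _

lemma IsFirstVariation.differentiableOn_firstVariation (hφ : IsFirstVariation X F μ φ)
    (hd : Differentiable ℝ φ) : DifferentiableOn ℝ (firstVariation X F μ) X := by
  obtain ⟨k, hk⟩ := hφ.exists_eqOn_add_const hφ.isFirstVariation_firstVariation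
  exact (hd.differentiableOn.add_const k).congr hk

lemma IsFirstVariation.wassersteinGrad_eq_gradient (hφ : IsFirstVariation X F μ φ)
    (hd : Differentiable ℝ φ) (hX : UniqueDiffOn ℝ X) {x : E d} (hx : x ∈ X) :
    wassersteinGrad X F μ x = gradient φ x := by
  obtain ⟨k, hk⟩ := hφ.exists_eqOn_add_const hφ.isFirstVariation_firstVariation
  rw [wassersteinGrad, gradientWithin, gradient, fderivWithin_congr hk (hk hx),
    fderivWithin_add_const, (hd x).fderivWithin (hX x hx)]

lemma IsFirstVariation.wassersteinGrad_ae_eq_gradient (hφ : IsFirstVariation X F μ φ)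
    (hd : Differentiable ℝ φ) (hX : UniqueDiffOn ℝ X) (hμ : MemP X μ) :
    wassersteinGrad X F μ =ᵐ[μ] gradient φ := by
  obtain ⟨_, K, hKX, -, hμK⟩ := hμ
  filter_upwards [show ∀ᵐ x ∂μ, x ∈ K from mem_ae_iff.2 hμK] with x hx
  exact hφ.wassersteinGrad_eq_gradient hd hX (hKX hx)

lemma HasBoundedDualDeriv.exists_hasDualDeriv (hF : HasBoundedDualDeriv F) (hμ : MemP X μ) :
    ∃ φ, HasDualDeriv F μ φ ∧ IsFirstVariation X F μ φ := by
  obtain ⟨hprob, K, -, hK, hμK⟩ := id hμ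
  obtain ⟨L, -, hL⟩ := hF K hK
  obtain ⟨φ, hφ, -⟩ := hL μ hprob hμK
  exact ⟨φ, hφ, hφ.isFirstVariation hμ⟩

theorem HasBoundedDualDeriv.isFirstVariation_firstVariation (hF : HasBoundedDualDeriv F)
    (hμ : MemP X μ) : IsFirstVariation X F μ (firstVariation X F μ) :=
  let ⟨_, _, hφ⟩ := hF.exists_hasDualDeriv hμ
  hφ.isFirstVariation_firstVariation

theorem HasBoundedDualDeriv.differentiableOn_firstVariation (hF : HasBoundedDualDeriv F)
    (hμ : MemP X μ) : DifferentiableOn ℝ (firstVariation X F μ) X :=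
  let ⟨_, hφ, hφX⟩ := hF.exists_hasDualDeriv hμ
  hφX.differentiableOn_firstVariation (hφ.contDiff.differentiable one_ne_zero)

theorem HasBoundedDualDeriv.integrable_norm_sq_wassersteinGrad (hF : HasBoundedDualDeriv F)
    (hX : UniqueDiffOn ℝ X) (hμ : MemP X μ) :
    Integrable (fun x => ‖wassersteinGrad X F μ x‖ ^ 2) μ := by
  obtain ⟨φ, hφ, hφX⟩ := hF.exists_hasDualDeriv hμ
  have hgrad := hφX.wassersteinGrad_ae_eq_gradient (hφ.contDiff.differentiable one_ne_zero) hX hμ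
  obtain ⟨_, K, -, hK, hμK⟩ := hμ
  refine (integrable_of_continuousOn_of_compl_null hK hμK
    ((continuous_gradient_of_contDiff hφ.contDiff).norm.pow 2).continuousOn).congr ?_
  filter_upwards [hgrad] with x hx
  rw [Pi.pow_apply, hx]

end FirstVariation

section WeakEquation

lemma hasDerivWithinAt_of_approx {F : Type*} [NormedAddCommGroup F] [NormedSpace ℝ F]
    {u : ℝ → F} {a : F} {J : Set ℝ} {t : ℝ}
    (happrox : ∀ η > 0, ∃ v b, HasDerivWithinAt v b J t ∧ ‖b - a‖ ≤ η ∧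
      ∀ᶠ s in 𝓝[J] t, ‖u s - u t - (v s - v t)‖ ≤ η * |s - t|) :
    HasDerivWithinAt u a J t := by
  rw [hasDerivWithinAt_iff_isLittleO, Asymptotics.isLittleO_iff]
  intro κ hκ
  obtain ⟨v, b, hv, hba, huv⟩ := happrox (κ / 3) (by positivity)
  rw [hasDerivWithinAt_iff_isLittleO, Asymptotics.isLittleO_iff] at hv
  filter_upwards [huv, hv (show 0 < κ / 3 by positivity)] with s hus hvs
  calc ‖u s - u t - (s - t) • a‖
      = ‖(u s - u t - (v s - v t)) + (v s - v t - (s - t) • b) + (s - t) • (b - a)‖ := by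
        rw [smul_sub]
        abel_nf
    _ ≤ κ / 3 * |s - t| + κ / 3 * |s - t| + |s - t| * (κ / 3) := by
        refine norm_add₃_le.trans (add_le_add_three hus hvs ?_)
        rw [norm_smul, Real.norm_eq_abs]
        gcongr
    _ = κ * ‖s - t‖ := by
        rw [Real.norm_eq_abs]
        ring

variable {V : Type*} [NormedAddCommGroup V] [NormedSpace ℝ V] [FiniteDimensional ℝ V]
  [MeasurableSpace V] [BorelSpace V] {K : Set V} {μ μ₀ : Measure V}

lemma hasDerivWithinAt_integral_of_weak (hK : IsCompact K) {m : ℝ → Measure V} {J : Set ℝ} {t : ℝ}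
    (ht : t ∈ J) (hm : DualLipschitzWithinAt K m J t) {w : V → V} (hw : ContinuousOn w K)
    (hweak : ∀ h : V → ℝ, ContDiff ℝ ∞ h → HasCompactSupport h →
      HasDerivWithinAt (fun s => ∫ x, h x ∂(m s)) (-∫ x, fderiv ℝ h x (w x) ∂(m t)) J t)
    {u : V → ℝ} (hu : ContDiff ℝ 1 u) :
    HasDerivWithinAt (fun s => ∫ x, u x ∂(m s)) (-∫ x, fderiv ℝ u x (w x) ∂(m t)) J t := by
  obtain ⟨_, hnull, -⟩ := hm.dualClose_self ht
  obtain ⟨C, -, hm⟩ := hm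
  obtain ⟨W, hW⟩ := hK.exists_bound_of_continuousOn hw
  refine hasDerivWithinAt_of_approx fun η hη => ?_
  obtain ⟨θ, hθ, hθη⟩ := exists_pos_mul_lt hη (max C W)
  obtain ⟨h, hh, hsupp, hhu⟩ := exists_contDiff_hasCompactSupport_approx hu hK hθ
  have hh₁ : ContDiff ℝ 1 h := hh.of_le (by simp)
  have hint {v : V → ℝ} (hv : ContDiff ℝ 1 v) {ρ : Measure V} [IsProbabilityMeasure ρ]
      (hρ : ρ Kᶜ = 0) : Integrable v ρ :=
    integrable_of_continuousOn_of_compl_null hK hρ hv.continuous.continuousOn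
  have hint' {v : V → ℝ} (hv : ContDiff ℝ 1 v) : Integrable (fun x => fderiv ℝ v x (w x)) (m t) :=
    integrable_of_continuousOn_of_compl_null hK hnull
      ((hv.continuous_fderiv one_ne_zero).continuousOn.clm_apply hw)
  refine ⟨_, _, hweak h hh hsupp, ?_, ?_⟩
  · rw [neg_sub_neg, ← integral_sub (hint' hu) (hint' hh₁)]
    refine norm_integral_le_of_compl_null hnull fun x hx => ?_
    rw [← sub_apply]
    refine (ContinuousLinearMap.le_of_opNorm_le_of_le _ (hhu x hx).2
      ((hW x hx).trans (le_max_right C W))).trans ?_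
    rw [mul_comm]
    exact hθη.le
  · filter_upwards [hm] with s hs
    have := hs.isProbabilityMeasure
    have hclose := hs.abs_integral_sub_le (fun x => u x - h x) θ (hu.sub hh₁)
      (fun x hx => (hhu x hx).1) fun x hx => by
        rw [fderiv_fun_sub (hu.differentiable one_ne_zero x) (hh₁.differentiable one_ne_zero x)]
        exact (hhu x hx).2
    rw [integral_sub (hint hu hs.compl_null) (hint hh₁ hs.compl_null),
      integral_sub (hint hu hnull) (hint hh₁ hnull), sub_sub_sub_comm] at hclose
    refine hclose.trans ?_
    rw [mul_right_comm]
    gcongr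
    exact (mul_le_mul_of_nonneg_right (le_max_left C W) hθ.le).trans hθη.le

lemma DualClose.of_contDiff_hasCompactSupport [IsProbabilityMeasure μ] [IsProbabilityMeasure μ₀]
    (hK : IsCompact K) (hμ : μ Kᶜ = 0) (hμ₀ : μ₀ Kᶜ = 0) {r : ℝ}
    (hclose : ∀ (h : V → ℝ) (B : ℝ), ContDiff ℝ ∞ h → HasCompactSupport h →
      (∀ x ∈ K, |h x| ≤ B) → (∀ x ∈ K, ‖fderiv ℝ h x‖ ≤ B) →
      |∫ x, h x ∂μ - ∫ x, h x ∂μ₀| ≤ r * B) :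
    DualClose K r μ μ₀ := by
  refine ⟨inferInstance, hμ, fun u B hu hB hB' => le_of_forall_pos_le_add fun e he => ?_⟩
  obtain ⟨θ, hθ, hθe⟩ := exists_pos_mul_lt he (2 + r)
  obtain ⟨h, hh, hsupp, hhu⟩ := exists_contDiff_hasCompactSupport_approx hu hK hθ
  have happrox {ρ : Measure V} [IsProbabilityMeasure ρ] (hρ : ρ Kᶜ = 0) :
      |∫ x, u x ∂ρ - ∫ x, h x ∂ρ| ≤ θ := by
    rw [← integral_sub
      (integrable_of_continuousOn_of_compl_null hK hρ hu.continuous.continuousOn)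
      (integrable_of_continuousOn_of_compl_null hK hρ hh.continuous.continuousOn)]
    exact norm_integral_le_of_compl_null hρ fun x hx => (hhu x hx).1
  have hsmooth := hclose h (B + θ) hh hsupp
    (fun x hx => (norm_le_norm_add_norm_sub _ _).trans (add_le_add (hB x hx) (hhu x hx).1))
    fun x hx => (norm_le_norm_add_norm_sub _ _).trans (add_le_add (hB' x hx) (hhu x hx).2)
  have hμh := abs_le.1 (happrox hμ)
  have hμ₀h := abs_le.1 (happrox hμ₀)
  rw [mul_add] at hsmooth
  exact abs_le.2 ⟨by linarith [(abs_le.1 hsmooth).1], by linarith [(abs_le.1 hsmooth).2]⟩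

end WeakEquation

section GradientFlow

variable {d : ℕ} {X K : Set (E d)} {F : Measure (E d) → ℝ} {J : Set ℝ} {m : ℝ → Measure (E d)}
  {t : ℝ}

namespace IsGradientFlow

lemma abs_integral_sub_le (hflow : IsGradientFlow X F J m) {I : Set ℝ} (hIJ : I ⊆ J)
    (hI : Convex ℝ I) (hnull : ∀ s ∈ I, m s Kᶜ = 0) {L : ℝ}
    (hL : ∀ s ∈ I, ∀ x ∈ K, ‖wassersteinGrad X F (m s) x‖ ≤ L) {h : E d → ℝ}
    (hh : ContDiff ℝ ∞ h) (hsupp : HasCompactSupport h) {B : ℝ}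
    (hB : ∀ x ∈ K, ‖fderiv ℝ h x‖ ≤ B) {s t : ℝ} (hs : s ∈ I) (ht : t ∈ I) :
    |∫ x, h x ∂(m s) - ∫ x, h x ∂(m t)| ≤ L * B * |s - t| := by
  refine hI.norm_image_sub_le_of_norm_hasDerivWithin_le (f := fun s => ∫ x, h x ∂(m s))
    (fun z hz => (hflow.weak h hh hsupp z (hIJ hz)).mono hIJ) (fun z hz => ?_) ht hs
  have := hflow.prob z (hIJ hz)
  rw [norm_neg]
  refine norm_integral_le_of_compl_null (hnull z hz) fun x hx => ?_
  rw [inner_gradient_right, conj_trivial, mul_comm]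
  exact ContinuousLinearMap.le_of_opNorm_le_of_le _ (hB x hx) (hL z hz x hx)

lemma exists_dualLipschitzWithinAt (hflow : IsGradientFlow X F J m) (hX : UniqueDiffOn ℝ X)
    (hF : HasBoundedDualDeriv F) (hJ : J.OrdConnected) (ht : t ∈ J) :
    ∃ K ⊆ X, IsCompact K ∧ DualLipschitzWithinAt K m J t := by
  obtain ⟨K, hKX, hK, hsupp⟩ := hflow.supp t ht
  obtain ⟨L, hL₀, hL⟩ := hF K hK
  obtain ⟨δ, hδ, hball⟩ := Metric.mem_nhdsWithin_iff.1 hsupp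
  have hgrad (s : ℝ) (hs : s ∈ Metric.ball t δ ∩ J) (x : E d) (hx : x ∈ K) :
      ‖wassersteinGrad X F (m s) x‖ ≤ L := by
    have := hflow.prob s hs.2
    obtain ⟨φ, hφ, hφL⟩ := hL (m s) inferInstance (hball hs)
    rw [(hφ.isFirstVariation ⟨inferInstance, K, hKX, hK, hball hs⟩).wassersteinGrad_eq_gradient
      (hφ.contDiff.differentiable one_ne_zero) hX (hKX hx), gradient, LinearIsometryEquiv.norm_map]
    exact hφL x hx
  have htI : t ∈ Metric.ball t δ ∩ J := ⟨Metric.mem_ball_self hδ, ht⟩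
  refine ⟨K, hKX, hK, L, hL₀, ?_⟩
  filter_upwards [inter_mem_nhdsWithin J (Metric.ball_mem_nhds t hδ)] with s hs
  have hsI : s ∈ Metric.ball t δ ∩ J := hs.symm
  have := hflow.prob s hs.1
  have := hflow.prob t ht
  refine .of_contDiff_hasCompactSupport hK (hball hsI) (hball htI)
    fun h B hh hsupp _ hB => ?_
  rw [mul_right_comm]
  exact hflow.abs_integral_sub_le inter_subset_right ((convex_ball t δ).inter hJ.convex)
    (fun z hz => hball hz) hgrad hh hsupp hB hsI htI

end IsGradientFlow

end GradientFlow

section EnergyDissipation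

variable {d : ℕ} {X : Set (E d)} {F : Measure (E d) → ℝ} {J : Set ℝ} {m : ℝ → Measure (E d)}
  {t : ℝ}

namespace IsGradientFlow

lemma memP (hflow : IsGradientFlow X F J m) (ht : t ∈ J) : MemP X (m t) :=
  let ⟨K, hKX, hK, hnull⟩ := hflow.supp t ht
  ⟨hflow.prob t ht, K, hKX, hK, hnull.self_of_nhdsWithin ht⟩

theorem hasDerivWithinAt (hflow : IsGradientFlow X F J m) (hX : UniqueDiffOn ℝ X)
    (hF : HasBoundedDualDeriv F) (hJ : J.OrdConnected) (ht : t ∈ J) :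
    HasDerivWithinAt (fun s => F (m s)) (-∫ x, ‖wassersteinGrad X F (m t) x‖ ^ 2 ∂(m t)) J t := by
  obtain ⟨K, -, hK, hm⟩ := hflow.exists_dualLipschitzWithinAt hX hF hJ ht
  obtain ⟨φ, hφ, hφX⟩ := hF.exists_hasDualDeriv (hflow.memP ht)
  have hgrad := hφX.wassersteinGrad_ae_eq_gradient (hφ.contDiff.differentiable one_ne_zero) hX
    (hflow.memP ht)
  have hweak (h : E d → ℝ) (hh : ContDiff ℝ ∞ h) (hsupp : HasCompactSupport h) :
      HasDerivWithinAt (fun s => ∫ x, h x ∂(m s))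
        (-∫ x, fderiv ℝ h x (gradient φ x) ∂(m t)) J t := by
    convert hflow.weak h hh hsupp t ht using 2
    refine integral_congr_ae ?_
    filter_upwards [hgrad] with x hx
    rw [hx, inner_gradient_right, conj_trivial]
  have hdissip : ∫ x, ‖wassersteinGrad X F (m t) x‖ ^ 2 ∂(m t)
      = ∫ x, fderiv ℝ φ x (gradient φ x) ∂(m t) := by
    refine integral_congr_ae ?_
    filter_upwards [hgrad] with x hx
    rw [hx, ← inner_gradient_left, real_inner_self_eq_norm_sq]
  rw [hdissip]
  exact hφ.comp_hasDerivWithinAt hK ht hm (hasDerivWithinAt_integral_of_weak hK ht hm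
    (continuous_gradient_of_contDiff hφ.contDiff).continuousOn hweak hφ.contDiff)

theorem antitoneOn (hflow : IsGradientFlow X F J m) (hX : UniqueDiffOn ℝ X)
    (hF : HasBoundedDualDeriv F) (hJ : J.OrdConnected) : AntitoneOn (fun t => F (m t)) J :=
  antitoneOn_of_hasDerivWithinAt_nonpos hJ.convex
    (fun _ ht => (hflow.hasDerivWithinAt hX hF hJ ht).continuousWithinAt)
    (fun _ ht => (hflow.hasDerivWithinAt hX hF hJ (interior_subset ht)).mono interior_subset)
    fun _ _ => neg_nonpos.2 (integral_nonneg fun _ => sq_nonneg _)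

end IsGradientFlow

end EnergyDissipation

end Sinkhorn

open Sinkhorn

theorem mainTheorem4_general {d : ℕ} (X : Set (E d)) (hX : UniqueDiffOn ℝ X)
    (c : E d → E d → ℝ) (hc : ContDiff ℝ 1 (Function.uncurry c)) (ε : ℝ) (hε : 0 < ε)
    (μs : Measure (E d)) (hμs : MemP X μs) (J : Set ℝ) (hJ : J.OrdConnected)
    (μ : ℝ → Measure (E d)) (hflow : IsGradientFlow X (sinkhornDiv c ε μs) J μ) :
    (∀ t ∈ J,
      IsFirstVariation X (sinkhornDiv c ε μs) (μ t)
        (firstVariation X (sinkhornDiv c ε μs) (μ t)) ∧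
      DifferentiableOn ℝ (firstVariation X (sinkhornDiv c ε μs) (μ t)) X ∧
      Integrable (fun x => ‖wassersteinGrad X (sinkhornDiv c ε μs) (μ t) x‖ ^ 2) (μ t) ∧
      HasDerivWithinAt (fun s => sinkhornDiv c ε μs (μ s))
        (-∫ x, ‖wassersteinGrad X (sinkhornDiv c ε μs) (μ t) x‖ ^ 2 ∂(μ t)) J t ∧
      -∫ x, ‖wassersteinGrad X (sinkhornDiv c ε μs) (μ t) x‖ ^ 2 ∂(μ t) ≤ 0) ∧
    AntitoneOn (fun t => sinkhornDiv c ε μs (μ t)) J := by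
  obtain ⟨_, K, -, hK, hμsK⟩ := hμs
  have hF : HasBoundedDualDeriv (sinkhornDiv c ε μs) :=
    hasBoundedDualDeriv_sinkhornDiv hc hε hK hμsK
  refine ⟨fun t ht => ⟨?_, ?_, ?_, ?_, ?_⟩, hflow.antitoneOn hX hF hJ⟩
  · exact hF.isFirstVariation_firstVariation (hflow.memP ht)
  · exact hF.differentiableOn_firstVariation (hflow.memP ht)
  · exact hF.integrable_norm_sq_wassersteinGrad hX (hflow.memP ht)
  · exact hflow.hasDerivWithinAt hX hF hJ ht
  · exact neg_nonpos.2 (integral_nonneg fun _ => sq_nonneg _)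

theorem mainTheorem4 {d : ℕ} (X : Set (Sinkhorn.E d)) (hX : UniqueDiffOn ℝ X)
    (c : Sinkhorn.E d → Sinkhorn.E d → ℝ) (hc : ContDiff ℝ 1 (Function.uncurry c))
    (hsymm : ∀ x y, c x y = c y x)
    (ε : ℝ) (hε : 0 < ε)
    (μs : Measure (Sinkhorn.E d)) (hμs : Sinkhorn.MemP X μs)
    (J : Set ℝ) (hJ : J.OrdConnected)
    (μ : ℝ → Measure (Sinkhorn.E d))
    (hflow : Sinkhorn.IsGradientFlow X (Sinkhorn.sinkhornDiv c ε μs) J μ) :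
    (∀ t ∈ J,
      Sinkhorn.IsFirstVariation X (Sinkhorn.sinkhornDiv c ε μs) (μ t)
        (Sinkhorn.firstVariation X (Sinkhorn.sinkhornDiv c ε μs) (μ t)) ∧
      DifferentiableOn ℝ (Sinkhorn.firstVariation X (Sinkhorn.sinkhornDiv c ε μs) (μ t)) X ∧
      Integrable
        (fun x => ‖Sinkhorn.wassersteinGrad X (Sinkhorn.sinkhornDiv c ε μs) (μ t) x‖ ^ 2) (μ t) ∧
      HasDerivWithinAt (fun s => Sinkhorn.sinkhornDiv c ε μs (μ s))
        (-∫ x, ‖Sinkhorn.wassersteinGrad X (Sinkhorn.sinkhornDiv c ε μs) (μ t) x‖ ^ 2 ∂(μ t))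
        J t ∧
      -∫ x, ‖Sinkhorn.wassersteinGrad X (Sinkhorn.sinkhornDiv c ε μs) (μ t) x‖ ^ 2 ∂(μ t) ≤ 0) ∧
    AntitoneOn (fun t => Sinkhorn.sinkhornDiv c ε μs (μ t)) J :=
  mainTheorem4_general X hX c hc ε hε μs hμs J hJ μ hflow
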